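/- Conventions. Let $\square$ be the category with objects $[1]^n$ ($n\ge 0$), $[1]=\{0<1\}$, whose morphisms are the order-preserving maps generated under composition by the faces (insert $\epsilon\in\{0,1\}$ as $i$-th coordinate), the degeneracies (forget the $i$-th coordinate) and the negative connections (replace the $i$-th and $(i+1)$-st coordinates by their maximum). Cubical sets are presheaves of sets on $\square$; $\square^n$ is the representable presheaf of $[1]^n$, and a vertex of $S$ is an element of $S_0=S([1]^0)$. For $a,b\in S_0$, $S_{a,b}$ denotes $S$ double pointed by $(a,b)$; $\square^n$ is double pointed by $\alpha=(0,\dots,0)$ and $\omega=(1,\dots,1)$. For double pointed cubical sets, $X\vee Y$ is the pushout identifying the second point of $X$ with the first point of $Y$, double pointed by the first point of $X$ and the second point of $Y$. A necklace is a double pointed cubical set $\square^{n_1}\vee\dots\vee\square^{n_k}$ with $k\ge 0$ and $n_i\ge 1$ (it is $\square^0$ if $k=0$); $\mathcal{N}ec$ is the full subcategory of double pointed cubical sets on the necklaces, and $\mathcal{N}ec\downarrow S_{a,b}$ is the category of necklaces $T$ with a map $T\to S_{a,b}$. The category $\mathrm{SubNeck}(S_{a,b})$ is the full subcategory of $\mathcal{N}ec\downarrow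 S_{a,b}$ on the maps $T\to S_{a,b}$ that are monomorphisms of cubical sets (its arrows are then automatically monomorphisms, and there is at most one arrow between two objects). Let $\mathrm I_n=(\square^1)^{\vee n}$. The category $\mathfrak C^\square_{path}(S)$ has the vertices of $S$ as objects; the morphisms from $a$ to $b$ are the maps $\mathrm I_n\to S_{a,b}$ ($n\ge0$) modulo the equivalence relation generated by $\gamma\sim\gamma'$ whenever $\gamma:\mathrm I_n\to S_{a,b}$ factors through $\gamma':\mathrm I_m\to S_{a,b}$ in double pointed cubical sets; composition is concatenation; the morphisms from $a$ to $b$ are preordered by the reflexive transitive closure of the relation $[F\circ s]\leadsto[F\circ t]$, for all maps $F:\mathrm I_k\vee\square^2\vee \mathrm I_j\to S_{a,b}$, where $s,t:\mathrm I_{k+2+j}\to \mathrm I_k\vee\square^2\vee \mathrm I_j$ are the identity on $\mathrm I_k$ and $\mathrm I_j$ and run along the edges $(0,0)\to(0,1)\to(1,1)$, respectively $(0,0)\to(1,0)\to(1,1)$, of $\square^2$. Let $N$ be the functor from categories enriched in preordered sets to simplicial categories that takes nerves of the preordered sets of morphisms. The rigidification functor $\mathfrak C^\square$ from cubical sets to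 small simplicial categories is the left Kan extension along the Yoneda embedding of $[1]^n\mapsto N(\mathfrak C^\square_{path}(\square^n))$. A vertex $a$ of $S$, seen as a map $\square^0\to S$, gives an object of $\mathfrak C^\square(S)$, also denoted by $a$, and $\mathfrak C^\square_t(S_{a,b}):=\mathfrak C^\square(S)(a,b)$ defines a functor from double pointed cubical sets to simplicial sets. Proposition. Let $n\ge 0$, let $S$ be a cubical subset of $\square^n$ (a cubical set with a monomorphism $S\to\square^n$), and let $a,b$ be vertices of $S$. Then the inclusion functor $\mathrm{SubNeck}(S_{a,b})\to\mathcal{N}ec\downarrow S_{a,b}$ is final, and the maps $\mathfrak C^\square_t(T)\to\mathfrak C^\square_t(S_{a,b})$ induced by the monomorphisms $T\to S_{a,b}$ form a colimit cocone of simplicial sets, so that $$\mathfrak C^\square(S)(a,b)=\mathfrak C^\square_t(S_{a,b})\;\cong\;\operatorname{colim}_{(T\to S_{a,b})\in \mathrm{SubNeck}(S_{a,b})}\mathfrak C^\square_t(T).$$ -/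

import Mathlib

open CategoryTheory Limits MonoidalCategory Opposite

noncomputable section

namespace CubicalRigidification

/-! ### Small simplicial categories -/

/-- A small simplicial category: a type of objects with an enrichment in simplicial sets. -/
structure SCat : Type 1 where
  Obj : Type
  [enriched : EnrichedCategory SSet.{0} Obj]

attribute [instance] SCat.enriched

namespace SCat

/-- The simplicial set of morphisms between two objects. -/
abbrev hom (C : SCat) (x y : C.Obj) : SSet.{0} := x ⟶[SSet.{0}] y

/-- A pair of simplices, as a simplex of the product. -/
def pair {X Y : SSet.{0}} {k : SimplexCategoryᵒᵖ} (x : X.obj k) (y : Y.obj k) : (X ⊗ Y).obj k :=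
  (x, y)

/-- Identity as a `k`-simplex. -/
def sId (C : SCat) (k : SimplexCategoryᵒᵖ) (x : C.Obj) : (C.hom x x).obj k :=
  (eId SSet.{0} x).app k PUnit.unit

/-- Composition of `k`-simplices of mapping spaces (in diagrammatic order). -/
def sComp (C : SCat) {k : SimplexCategoryᵒᵖ} {x y z : C.Obj}
    (f : (C.hom x y).obj k) (g : (C.hom y z).obj k) : (C.hom x z).obj k :=
  (eComp SSet.{0} x y z).app k (pair f g)

/-- Simplicial categories and simplicially enriched functors. -/
instance : Category SCat where
  Hom C D := EnrichedFunctor SSet.{0} C.Obj D.Obj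
  id C := EnrichedFunctor.id SSet.{0} C.Obj
  comp F G := EnrichedFunctor.comp SSet.{0} F G

/-- Action of a simplicial functor on `k`-simplices of mapping spaces. -/
def sMap {C D : SCat} (F : C ⟶ D) {k : SimplexCategoryᵒᵖ} {x y : C.Obj}
    (f : (C.hom x y).obj k) : (D.hom (F.obj x) (F.obj y)).obj k :=
  (F.map x y).app k f

section lemmas

variable {C D E : SCat} {k l : SimplexCategoryᵒᵖ}

lemma sId_comp {x y : C.Obj} (f : (C.hom x y).obj k) : C.sComp (C.sId k x) f = f :=
  ConcreteCategory.congr_hom (NatTrans.congr_app (e_id_comp SSet.{0} x y) k) f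

lemma sComp_id {x y : C.Obj} (f : (C.hom x y).obj k) : C.sComp f (C.sId k y) = f :=
  ConcreteCategory.congr_hom (NatTrans.congr_app (e_comp_id SSet.{0} x y) k) f

lemma s_assoc {x y z w : C.Obj} (f : (C.hom x y).obj k) (g : (C.hom y z).obj k)
    (h : (C.hom z w).obj k) : C.sComp (C.sComp f g) h = C.sComp f (C.sComp g h) := by
  let p : (C.hom x y ⊗ (C.hom y z ⊗ C.hom z w)).obj k := pair f (pair g h)
  have e := ConcreteCategory.congr_hom (NatTrans.congr_app (e_assoc SSet.{0} x y z w) k) p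
  exact e

lemma map_sId (θ : k ⟶ l) (x : C.Obj) : (C.hom x x).map θ (C.sId k x) = C.sId l x :=
  (ConcreteCategory.congr_hom ((eId SSet.{0} x).naturality θ) PUnit.unit).symm

lemma map_sComp (θ : k ⟶ l) {x y z : C.Obj} (f : (C.hom x y).obj k) (g : (C.hom y z).obj k) :
    (C.hom x z).map θ (C.sComp f g) =
      C.sComp ((C.hom x y).map θ f) ((C.hom y z).map θ g) := by
  let p : (C.hom x y ⊗ C.hom y z).obj k := pair f g
  have e := ConcreteCategory.congr_hom ((eComp SSet.{0} x y z).naturality θ) p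
  exact e.symm

lemma sMap_sId (F : C ⟶ D) (x : C.Obj) : sMap F (C.sId k x) = D.sId k (F.obj x) :=
  ConcreteCategory.congr_hom (NatTrans.congr_app (F.map_id x) k) PUnit.unit

lemma sMap_sComp (F : C ⟶ D) {x y z : C.Obj} (f : (C.hom x y).obj k) (g : (C.hom y z).obj k) :
    sMap F (C.sComp f g) = D.sComp (sMap F f) (sMap F g) := by
  let p : (C.hom x y ⊗ C.hom y z).obj k := pair f g
  have e := ConcreteCategory.congr_hom (NatTrans.congr_app (F.map_comp x y z) k) p
  exact e

lemma map_sMap (F : C ⟶ D) (θ : k ⟶ l) {x y : C.Obj} (f : (C.hom x y).obj k) :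
    (D.hom _ _).map θ (sMap F f) = sMap F ((C.hom x y).map θ f) :=
  (ConcreteCategory.congr_hom ((F.map x y).naturality θ) f).symm

lemma hext {F G : C ⟶ D} (hobj : ∀ x, F.obj x = G.obj x)
    (hmap : ∀ (k : SimplexCategoryᵒᵖ) (x y : C.Obj) (f : (C.hom x y).obj k),
      HEq (sMap F f) (sMap G f)) : F = G := by
  match F, G with
  | .mk F_obj F_map _ _, .mk G_obj G_map _ _ =>
    obtain rfl : F_obj = G_obj := funext hobj
    congr
    ext x y k f
    exact eq_of_heq (hmap k x y f)

lemma sMap_heq {F G : C ⟶ D} (h : F = G) {x y : C.Obj} (f : (C.hom x y).obj k) :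
    HEq (sMap F f) (sMap G f) := by
  subst h; rfl

lemma sComp_heq {x y z x' y' z' : C.Obj} (hx : x = x') (hy : y = y') (hz : z = z')
    {f : (C.hom x y).obj k} {g : (C.hom y z).obj k}
    {f' : (C.hom x' y').obj k} {g' : (C.hom y' z').obj k} (hf : HEq f f') (hg : HEq g g') :
    HEq (C.sComp f g) (C.sComp f' g') := by
  subst hx hy hz; cases hf; cases hg; rfl

end lemmas

/-- Transport of simplices of mapping spaces along equalities of objects. -/
def castHom (C : SCat) {k : SimplexCategoryᵒᵖ} {x y x' y' : C.Obj} (hx : x = x') (hy : y = y')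
    (f : (C.hom x y).obj k) : (C.hom x' y').obj k :=
  hx ▸ hy ▸ f

lemma castHom_heq (C : SCat) {k : SimplexCategoryᵒᵖ} {x y x' y' : C.Obj} (hx : x = x')
    (hy : y = y') (f : (C.hom x y).obj k) : HEq (C.castHom hx hy f) f := by
  subst hx hy; rfl

/-- A constructor for simplicial categories, from levelwise data. -/
@[reducible]
def mkEnriched (O : Type) (H : O → O → SSet.{0})
    (e : ∀ (k : SimplexCategoryᵒᵖ) (x : O), (H x x).obj k)
    (c : ∀ {k : SimplexCategoryᵒᵖ} {x y z : O},
      (H x y).obj k → (H y z).obj k → (H x z).obj k)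
    (map_e : ∀ {k l} (θ : k ⟶ l) (x : O), (H x x).map θ (e k x) = e l x)
    (map_c : ∀ {k l} (θ : k ⟶ l) {x y z : O} (f : (H x y).obj k) (g : (H y z).obj k),
      (H x z).map θ (c f g) = c ((H x y).map θ f) ((H y z).map θ g))
    (e_c : ∀ {k x y} (f : (H x y).obj k), c (e k x) f = f)
    (c_e : ∀ {k x y} (f : (H x y).obj k), c f (e k y) = f)
    (assoc : ∀ {k x y z w} (f : (H x y).obj k) (g : (H y z).obj k) (h : (H z w).obj k),
      c (c f g) h = c f (c g h)) : EnrichedCategory SSet.{0} O where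
  Hom := H
  id x :=
    { app := fun k => ↾fun _ => e k x
      naturality := fun k l θ => by
        ext; exact (map_e θ x).symm }
  comp x y z :=
    { app := fun k => ↾fun p => c p.1 p.2
      naturality := fun k l θ => by
        ext p; exact (map_c θ p.1 p.2).symm }
  id_comp x y := by ext k f; exact e_c f
  comp_id x y := by ext k f; exact c_e f
  assoc x y z w := by ext k p; exact assoc p.1 p.2.1 p.2.2

/-- A constructor for simplicial functors, from levelwise data. -/
def mkFunctor {C D : SCat} (o : C.Obj → D.Obj)
    (m : ∀ {k : SimplexCategoryᵒᵖ} {x y : C.Obj},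
      (C.hom x y).obj k → (D.hom (o x) (o y)).obj k)
    (map_m : ∀ {k l} (θ : k ⟶ l) {x y : C.Obj} (f : (C.hom x y).obj k),
      (D.hom _ _).map θ (m f) = m ((C.hom x y).map θ f))
    (m_id : ∀ k x, m (C.sId k x) = D.sId k (o x))
    (m_comp : ∀ {k x y z} (f : (C.hom x y).obj k) (g : (C.hom y z).obj k),
      m (C.sComp f g) = D.sComp (m f) (m g)) : C ⟶ D :=
  EnrichedFunctor.mk (V := SSet.{0}) (C := C.Obj) (D := D.Obj) o
    (fun x y =>
      { app := fun k => ↾fun f => m f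
        naturality := fun k l θ => by
          ext f; exact (map_m θ f).symm })
    (fun x => by ext k ⟨⟩; exact m_id k x)
    (fun x y z => by ext k p; exact m_comp p.1 p.2)

/-! ### Colimits of simplicial categories -/

section colimits

variable {J : Type} [SmallCategory J] (F : J ⥤ SCat)

namespace Colim

/-- The objects of the colimit: the colimit of the sets of objects. -/
def Ob : Type :=
  Quot fun p q : Σ j, (F.obj j).Obj => ∃ f : p.1 ⟶ q.1, (F.map f).obj p.2 = q.2

variable {F} in
/-- The class of an object in the colimit. -/
def ob (j : J) (x : (F.obj j).Obj) : Ob F := Quot.mk _ ⟨j, x⟩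

variable {F} in
lemma ob_map {j j' : J} (f : j ⟶ j') (x : (F.obj j).Obj) :
    ob j' ((F.map f).obj x) = ob (F := F) j x :=
  (Quot.sound ⟨f, rfl⟩).symm

/-- Formal composites of `k`-simplices of mapping spaces of the diagram. -/
inductive Word (k : SimplexCategoryᵒᵖ) : Ob F → Ob F → Type
  | one (a : Ob F) : Word k a a
  | gen {a b : Ob F} (j : J) (x y : (F.obj j).Obj) (s : ((F.obj j).hom x y).obj k)
      (ha : ob j x = a) (hb : ob j y = b) : Word k a b
  | comp {a b c : Ob F} (u : Word k a b) (v : Word k b c) : Word k a c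

variable {F}

/-- The relations between formal composites: category axioms, functoriality of the inclusion of
each simplicial category of the diagram, compatibility with the transition functors. -/
inductive Rel {k : SimplexCategoryᵒᵖ} :
    ∀ {a b : Ob F}, Word F k a b → Word F k a b → Prop
  | one_comp {a b} (u : Word F k a b) : Rel (.comp (.one a) u) u
  | comp_one {a b} (u : Word F k a b) : Rel (.comp u (.one b)) u
  | assoc {a b c d} (u : Word F k a b) (v : Word F k b c) (w : Word F k c d) :
      Rel (.comp (.comp u v) w) (.comp u (.comp v w))
  | congr_left {a b c} {u u' : Word F k a b} (v : Word F k b c) (h : Rel u u') :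
      Rel (.comp u v) (.comp u' v)
  | congr_right {a b c} (u : Word F k a b) {v v' : Word F k b c} (h : Rel v v') :
      Rel (.comp u v) (.comp u v')
  | gen_id {a} (j : J) (x : (F.obj j).Obj) (ha : ob j x = a) :
      Rel (.gen j x x ((F.obj j).sId k x) ha ha) (.one a)
  | gen_comp {a b c} (j : J) (x y z : (F.obj j).Obj) (s : ((F.obj j).hom x y).obj k)
      (t : ((F.obj j).hom y z).obj k) (ha : ob j x = a) (hb : ob j y = b) (hc : ob j z = c) :
      Rel (.gen j x z ((F.obj j).sComp s t) ha hc) (.comp (.gen j x y s ha hb) (.gen j y z t hb hc))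
  | gen_map {a b} {j j' : J} (f : j ⟶ j') (x y : (F.obj j).Obj)
      (s : ((F.obj j).hom x y).obj k) (ha : ob j x = a) (hb : ob j y = b)
      (ha' : ob j' ((F.map f).obj x) = a) (hb' : ob j' ((F.map f).obj y) = b) :
      Rel (.gen j' _ _ (sMap (F.map f) s) ha' hb') (.gen j x y s ha hb)

/-- Simplicial operators act on formal composites. -/
def Word.map {k l : SimplexCategoryᵒᵖ} (θ : k ⟶ l) :
    ∀ {a b : Ob F}, Word F k a b → Word F l a b
  | _, _, .one a => .one a
  | _, _, .gen j x y s ha hb => .gen j x y (((F.obj j).hom x y).map θ s) ha hb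
  | _, _, .comp u v => .comp (u.map θ) (v.map θ)

lemma Rel.map {k l : SimplexCategoryᵒᵖ} (θ : k ⟶ l) {a b : Ob F} {u v : Word F k a b}
    (h : Rel u v) : Rel (u.map θ) (v.map θ) := by
  induction h with
  | one_comp u => exact .one_comp _
  | comp_one u => exact .comp_one _
  | assoc u v w => exact .assoc _ _ _
  | congr_left v h ih => exact .congr_left _ ih
  | congr_right u h ih => exact .congr_right _ ih
  | gen_id j x ha =>
    simp only [Word.map, map_sId]; exact .gen_id j x ha
  | gen_comp j x y z s t ha hb hc =>
    simp only [Word.map, map_sComp]; exact .gen_comp j x y z _ _ ha hb hc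
  | gen_map f x y s ha hb ha' hb' =>
    simp only [Word.map, map_sMap]; exact .gen_map f x y _ ha hb ha' hb'

lemma Word.map_id {k : SimplexCategoryᵒᵖ} {a b : Ob F} (u : Word F k a b) :
    u.map (𝟙 k) = u := by
  induction u with
  | one a => rfl
  | gen j x y s ha hb => simp [Word.map]
  | comp u v hu hv => simp [Word.map, hu, hv]

lemma Word.map_comp {k l m : SimplexCategoryᵒᵖ} (θ : k ⟶ l) (η : l ⟶ m) {a b : Ob F}
    (u : Word F k a b) : u.map (θ ≫ η) = (u.map θ).map η := by
  induction u with
  | one a => rfl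
  | gen j x y s ha hb => simp [Word.map]
  | comp u v hu hv => simp [Word.map, hu, hv]

variable (F) in
/-- The mapping spaces of the colimit. -/
def homs (a b : Ob F) : SSet.{0} where
  obj k := Quot (Rel (F := F) (k := k) (a := a) (b := b))
  map θ := ↾(Quot.map (Word.map θ) fun _ _ h => h.map θ)
  map_id k := by
    ext u
    induction u using Quot.ind with | _ u => exact congrArg (Quot.mk _) u.map_id
  map_comp θ η := by
    ext u
    induction u using Quot.ind with | _ u => exact congrArg (Quot.mk _) (u.map_comp θ η)

variable (F) in
/-- The colimit of a diagram of simplicial categories. -/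
def pt : SCat where
  Obj := Ob F
  enriched := mkEnriched (Ob F) (homs F)
    (fun k a => Quot.mk _ (.one a))
    (fun u v => Quot.map₂ Word.comp (fun u _ _ h => .congr_right u h)
      (fun _ _ v h => .congr_left v h) u v)
    (fun θ x => rfl)
    (fun θ _ _ _ u v => by
      induction u using Quot.ind; induction v using Quot.ind; rfl)
    (fun u => by induction u using Quot.ind; exact Quot.sound (.one_comp _))
    (fun u => by induction u using Quot.ind; exact Quot.sound (.comp_one _))
    (fun u v w => by
      induction u using Quot.ind; induction v using Quot.ind; induction w using Quot.ind
      exact Quot.sound (.assoc _ _ _))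

variable (F) in
/-- The class of a formal composite. -/
def cls {k : SimplexCategoryᵒᵖ} {a b : Ob F} (u : Word F k a b) : ((pt F).hom a b).obj k :=
  Quot.mk _ u

lemma cls_comp {k : SimplexCategoryᵒᵖ} {a b c : Ob F} (u : Word F k a b) (v : Word F k b c) :
    cls F (.comp u v) = (pt F).sComp (cls F u) (cls F v) := rfl

variable (F) in
/-- The colimit cocone. -/
def cocone : Cocone F where
  pt := pt F
  ι :=
    { app := fun j => mkFunctor (C := F.obj j) (D := pt F) (ob j)
        (fun s => cls F (.gen j _ _ s rfl rfl))
        (fun θ _ _ f => rfl)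
        (fun k x => Quot.sound (.gen_id j x rfl))
        (fun f g => Quot.sound (.gen_comp j _ _ _ f g rfl rfl rfl))
      naturality := fun j j' f => by
        refine hext (fun x => ob_map f x) fun k x y s => ?_
        have h : cls F (.gen j' _ _ (sMap (F.map f) s) (ob_map f x) (ob_map f y)) =
          cls F (.gen j x y s rfl rfl) := Quot.sound (.gen_map f x y s rfl rfl _ _)
        refine HEq.trans ?_ (heq_of_eq h)
        have : ∀ {a b : Ob F} (ha : ob j' ((F.map f).obj x) = a) (hb : ob j' ((F.map f).obj y) = b),
            HEq (cls F (.gen j' _ _ (sMap (F.map f) s) rfl rfl))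
              (cls F (.gen j' _ _ (sMap (F.map f) s) ha hb)) := by
          rintro _ _ rfl rfl; rfl
        exact this _ _ }

/-- The map on objects induced by a cocone. -/
def descOb (c : Cocone F) : Ob F → c.pt.Obj :=
  Quot.lift (fun p => (c.ι.app p.1).obj p.2) (by
    rintro ⟨j, x⟩ ⟨j', y⟩ ⟨f, h⟩
    refine (congrArg (fun G : F.obj j ⟶ c.pt => G.obj x) (c.w f).symm).trans ?_
    exact congrArg (fun z => (c.ι.app j').obj z) h)

/-- The map on formal composites induced by a cocone. -/
def eval (c : Cocone F) {k : SimplexCategoryᵒᵖ} :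
    ∀ {a b : Ob F}, Word F k a b → (c.pt.hom (descOb c a) (descOb c b)).obj k
  | _, _, .one a => c.pt.sId k _
  | _, _, .gen j _ _ s ha hb =>
    c.pt.castHom (congrArg (descOb c) ha) (congrArg (descOb c) hb) (sMap (c.ι.app j) s)
  | _, _, .comp u v => c.pt.sComp (eval c u) (eval c v)

lemma eval_gen_heq (c : Cocone F) {k : SimplexCategoryᵒᵖ} {a b : Ob F} {j : J}
    {x y : (F.obj j).Obj} (s : ((F.obj j).hom x y).obj k) (ha : ob j x = a) (hb : ob j y = b) :
    HEq (eval c (.gen j x y s ha hb)) (sMap (c.ι.app j) s) :=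
  castHom_heq _ _ _ _

lemma eval_rel (c : Cocone F) {k : SimplexCategoryᵒᵖ} {a b : Ob F} {u v : Word F k a b}
    (h : Rel u v) : eval c u = eval c v := by
  induction h with
  | one_comp u => exact sId_comp _
  | comp_one u => exact sComp_id _
  | assoc u v w => exact s_assoc _ _ _
  | congr_left v h ih => simp only [eval, ih]
  | congr_right u h ih => simp only [eval, ih]
  | gen_id j x ha => subst ha; exact sMap_sId _ _
  | gen_comp j x y z s t ha hb hc => subst ha hb hc; exact sMap_sComp _ _ _
  | gen_map f x y s ha hb ha' hb' =>
    refine eq_of_heq ((eval_gen_heq _ _ _ _).trans (HEq.trans ?_ (eval_gen_heq _ _ _ _).symm))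
    exact sMap_heq (c.w f) s

lemma eval_map (c : Cocone F) {k l : SimplexCategoryᵒᵖ} (θ : k ⟶ l) {a b : Ob F}
    (u : Word F k a b) : (c.pt.hom _ _).map θ (eval c u) = eval c (u.map θ) := by
  induction u with
  | one a => exact map_sId _ _
  | gen j x y s ha hb => subst ha hb; exact map_sMap _ _ _
  | comp u v hu hv => simp only [eval, Word.map, map_sComp, hu, hv]

/-- The functor out of the colimit induced by a cocone. -/
def desc (c : Cocone F) : pt F ⟶ c.pt :=
  mkFunctor (C := pt F) (descOb c)
    (fun u => Quot.lift (eval c) (fun _ _ h => eval_rel c h) u)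
    (fun θ _ _ u => by induction u using Quot.ind; exact eval_map c θ _)
    (fun k x => rfl)
    (fun u v => by induction u using Quot.ind; induction v using Quot.ind; rfl)

variable (F) in
/-- The colimit cocone is colimiting. -/
def isColimit : IsColimit (cocone F) where
  desc c := desc c
  fac c j := by
    refine hext (fun x => rfl) fun k x y s => ?_
    exact eval_gen_heq c s rfl rfl
  uniq c m hm := by
    have ho : ∀ a : Ob F, m.obj a = descOb c a := by
      rintro ⟨j, x⟩
      exact congrArg (fun G : F.obj j ⟶ c.pt => G.obj x) (hm j)
    have hw : ∀ {k : SimplexCategoryᵒᵖ} {a b : Ob F} (u : Word F k a b),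
        HEq (sMap m (cls F u)) (eval c u) := by
      intro k a b u
      induction u with
      | one a =>
        have h1 : sMap m (cls F (.one a)) = c.pt.sId k (m.obj a) := sMap_sId m a
        refine (heq_of_eq h1).trans ?_
        show HEq (c.pt.sId k (m.obj a)) (c.pt.sId k (descOb c a))
        rw [ho a]
      | gen j x y s ha hb =>
        subst ha hb
        exact (sMap_heq (hm j) s).trans (eval_gen_heq c s rfl rfl).symm
      | comp u v hu hv =>
        refine (heq_of_eq (sMap_sComp (C := pt F) m (cls F u) (cls F v))).trans ?_
        exact sComp_heq (ho _) (ho _) (ho _) hu hv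
    refine hext ho fun k a b u => ?_
    induction u using Quot.ind with | _ u => exact hw u

end Colim

instance : HasColimitsOfSize.{0, 0} SCat where
  has_colimits_of_shape _ _ :=
    { has_colimit := fun F => ⟨⟨Colim.cocone F, Colim.isColimit F⟩⟩ }

end colimits

end SCat

/-! ### The cube category with faces, degeneracies and negative connections -/

/-- The object `[1]^dim` of the cube category. -/
structure Box : Type where
  dim : ℕ

namespace Box

/-- The face inserting `ε` as `i`-th coordinate (coordinates are numbered from `0`). -/
def face {n : ℕ} (i : Fin (n + 1)) (ε : Bool) (x : Fin n → Bool) : Fin (n + 1) → Bool :=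
  Fin.insertNth (α := fun _ => Bool) i ε x

/-- The degeneracy forgetting the `i`-th coordinate. -/
def degen {n : ℕ} (i : Fin (n + 1)) (x : Fin (n + 1) → Bool) : Fin n → Bool :=
  fun j => x (i.succAbove j)

/-- The negative connection replacing the `i`-th and `(i+1)`-st coordinates by their maximum. -/
def conn {n : ℕ} (i : Fin n) (x : Fin (n + 1) → Bool) : Fin n → Bool :=
  fun j => if j < i then x j.castSucc
    else if j = i then max (x j.castSucc) (x j.succ)
    else x j.succ

/-- The maps `[1]^m → [1]^n` generated under composition by faces, degeneracies and negative
connections (all of which are order preserving). -/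
inductive IsBoxMap : ∀ {m n : ℕ}, ((Fin m → Bool) → (Fin n → Bool)) → Prop
  | id (n : ℕ) : IsBoxMap (fun x : Fin n → Bool => x)
  | comp {l m n : ℕ} {f : (Fin l → Bool) → (Fin m → Bool)} {g : (Fin m → Bool) → (Fin n → Bool)}
      (hf : IsBoxMap f) (hg : IsBoxMap g) : IsBoxMap (fun x => g (f x))
  | face {n : ℕ} (i : Fin (n + 1)) (ε : Bool) : IsBoxMap (face i ε)
  | degen {n : ℕ} (i : Fin (n + 1)) : IsBoxMap (degen i)
  | conn {n : ℕ} (i : Fin n) : IsBoxMap (conn i)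

/-- Morphisms of the cube category. -/
@[ext]
structure Hom (m n : Box) : Type where
  toFun : (Fin m.dim → Bool) → (Fin n.dim → Bool)
  isBoxMap : IsBoxMap toFun

instance : SmallCategory Box where
  Hom := Hom
  id m := ⟨fun x => x, .id _⟩
  comp f g := ⟨fun x => g.toFun (f.toFun x), f.isBoxMap.comp g.isBoxMap⟩

@[ext]
lemma hom_ext {m n : Box} {f g : m ⟶ n} (h : ∀ x, f.toFun x = g.toFun x) : f = g :=
  Hom.ext (funext h)

lemma isBoxMap_const {n : ℕ} (v : Fin n → Bool) : IsBoxMap (fun _ : Fin 0 → Bool => v) := by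
  induction n with
  | zero =>
    have : (fun _ : Fin 0 → Bool => v) = fun x => x := by
      funext x j; exact j.elim0
    rw [this]; exact .id 0
  | succ n ih =>
    have : (fun _ : Fin 0 → Bool => v) =
        fun x => face 0 (v 0) ((fun _ : Fin 0 → Bool => fun j : Fin n => v j.succ) x) := by
      funext x j
      refine Fin.cases ?_ (fun j => ?_) j
      · simp [face]
      · simp [face]
    rw [this]
    exact .comp (ih _) (.face _ _)

/-- A vertex of `[1]^n` as a morphism from `[1]^0`. -/
def vertex {n : ℕ} (v : Fin n → Bool) : (⟨0⟩ : Box) ⟶ ⟨n⟩ := ⟨fun _ => v, isBoxMap_const v⟩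

/-- The face maps as morphisms of the cube category. -/
def δ {n : ℕ} (i : Fin (n + 1)) (ε : Bool) : (⟨n⟩ : Box) ⟶ ⟨n + 1⟩ := ⟨face i ε, .face i ε⟩

lemma vertex_comp {n : ℕ} {m : Box} (v : Fin n → Bool) (f : (⟨n⟩ : Box) ⟶ m) :
    vertex v ≫ f = vertex (f.toFun v) := rfl

end Box

/-- The category of cubical sets. -/
abbrev CubicalSet : Type 1 := Boxᵒᵖ ⥤ Type

/-- The `n`-cube. -/
abbrev cube (n : ℕ) : CubicalSet := yoneda.obj (⟨n⟩ : Box)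

/-- The vertices of a cubical set. -/
abbrev CubicalSet.Vertex (S : CubicalSet) : Type := S.obj (op (⟨0⟩ : Box))

/-- The map from the `0`-cube (the terminal cubical set) corresponding to a vertex. -/
def CubicalSet.pt {S : CubicalSet} (a : S.Vertex) : cube 0 ⟶ S := yonedaEquiv.symm a

lemma CubicalSet.pt_comp {S T : CubicalSet} (a : S.Vertex) (f : S ⟶ T) :
    pt a ≫ f = pt (f.app _ a) := yonedaEquiv_symm_naturality_right _ _ _

/-! ### Double pointed cubical sets and concatenation -/

/-- Double pointed cubical sets. -/
structure Bip : Type 1 where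
  X : CubicalSet
  src : cube 0 ⟶ X
  tgt : cube 0 ⟶ X

namespace Bip

/-- Maps of double pointed cubical sets. -/
@[ext]
structure Hom (P Q : Bip) : Type where
  hom : P.X ⟶ Q.X
  src : P.src ≫ hom = Q.src
  tgt : P.tgt ≫ hom = Q.tgt

instance : Category Bip where
  Hom := Hom
  id P := ⟨𝟙 _, Category.comp_id _, Category.comp_id _⟩
  comp f g := ⟨f.hom ≫ g.hom, by rw [← Category.assoc, f.src, g.src],
    by rw [← Category.assoc, f.tgt, g.tgt]⟩

@[simp]
lemma id_hom (P : Bip) : Hom.hom (𝟙 P) = 𝟙 P.X := rfl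

@[simp]
lemma comp_hom {P Q R : Bip} (f : P ⟶ Q) (g : Q ⟶ R) : (f ≫ g).hom = f.hom ≫ g.hom := rfl

lemma comp_hom_assoc {P Q R : Bip} (f : P ⟶ Q) (g : Q ⟶ R) {Z : CubicalSet}
    (t : R.X ⟶ Z) : Hom.hom (f ≫ g) ≫ t = f.hom ≫ g.hom ≫ t := Category.assoc _ _ _

@[ext]
lemma hom_ext {P Q : Bip} {f g : P ⟶ Q} (h : f.hom = g.hom) : f = g := Hom.ext h

@[simp]
lemma src_hom {P Q : Bip} (f : P ⟶ Q) : P.src ≫ f.hom = Q.src := f.src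

@[simp]
lemma src_hom_assoc {P Q : Bip} (f : P ⟶ Q)
    {Z : CubicalSet} (t : _ ⟶ Z) : P.src ≫ f.hom ≫ t = Q.src ≫ t := by
  rw [← Category.assoc, src_hom]

@[simp]
lemma tgt_hom {P Q : Bip} (f : P ⟶ Q) : P.tgt ≫ f.hom = Q.tgt := f.tgt

@[simp]
lemma tgt_hom_assoc {P Q : Bip} (f : P ⟶ Q)
    {Z : CubicalSet} (t : _ ⟶ Z) : P.tgt ≫ f.hom ≫ t = Q.tgt ≫ t := by
  rw [← Category.assoc, tgt_hom]

/-- The `0`-cube, double pointed by itself. -/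
def unit : Bip := ⟨cube 0, 𝟙 _, 𝟙 _⟩

/-- The `n`-cube, double pointed by its least and greatest vertices. -/
def box (n : ℕ) : Bip :=
  ⟨cube n, yoneda.map (Box.vertex fun _ => false), yoneda.map (Box.vertex fun _ => true)⟩

/-- The wedge sum (concatenation product), identifying `P.tgt` with `Q.src`. -/
def wedge (P Q : Bip) : Bip :=
  ⟨pushout P.tgt Q.src, P.src ≫ pushout.inl _ _, Q.tgt ≫ pushout.inr _ _⟩

/-- The inclusion of the first summand of a wedge. -/
def inl (P Q : Bip) : P.X ⟶ (wedge P Q).X := pushout.inl P.tgt Q.src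

/-- The inclusion of the second summand of a wedge. -/
def inr (P Q : Bip) : Q.X ⟶ (wedge P Q).X := pushout.inr P.tgt Q.src

lemma condition (P Q : Bip) : P.tgt ≫ inl P Q = Q.src ≫ inr P Q := pushout.condition

lemma condition_assoc (P Q : Bip)
    {Z : CubicalSet} (t : _ ⟶ Z) : P.tgt ≫ inl P Q ≫ t = Q.src ≫ inr P Q ≫ t := by
  rw [← Category.assoc, condition, Category.assoc]

@[simp]
lemma wedge_src (P Q : Bip) : P.src ≫ inl P Q = (wedge P Q).src := rfl

@[simp]
lemma wedge_src_assoc (P Q : Bip)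
    {Z : CubicalSet} (t : _ ⟶ Z) : P.src ≫ inl P Q ≫ t = (wedge P Q).src ≫ t := by
  rw [← Category.assoc, wedge_src]

@[simp]
lemma wedge_tgt (P Q : Bip) : Q.tgt ≫ inr P Q = (wedge P Q).tgt := rfl

@[simp]
lemma wedge_tgt_assoc (P Q : Bip)
    {Z : CubicalSet} (t : _ ⟶ Z) : Q.tgt ≫ inr P Q ≫ t = (wedge P Q).tgt ≫ t := by
  rw [← Category.assoc, wedge_tgt]

/-- The universal property of the wedge. -/
def desc {P Q : Bip} {S : CubicalSet} (f : P.X ⟶ S) (g : Q.X ⟶ S) (h : P.tgt ≫ f = Q.src ≫ g) :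
    (wedge P Q).X ⟶ S := pushout.desc f g h

@[simp]
lemma inl_desc {P Q : Bip} {S : CubicalSet} (f : P.X ⟶ S) (g : Q.X ⟶ S)
    (h : P.tgt ≫ f = Q.src ≫ g) : inl P Q ≫ desc f g h = f := pushout.inl_desc _ _ _

@[simp]
lemma inl_desc_assoc {P Q : Bip} {S : CubicalSet} (f : P.X ⟶ S) (g : Q.X ⟶ S)
    (h : P.tgt ≫ f = Q.src ≫ g)
    {Z : CubicalSet} (t : _ ⟶ Z) : inl P Q ≫ desc f g h ≫ t = f ≫ t := by
  rw [← Category.assoc, inl_desc]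

@[simp]
lemma inr_desc {P Q : Bip} {S : CubicalSet} (f : P.X ⟶ S) (g : Q.X ⟶ S)
    (h : P.tgt ≫ f = Q.src ≫ g) : inr P Q ≫ desc f g h = g := pushout.inr_desc _ _ _

@[simp]
lemma inr_desc_assoc {P Q : Bip} {S : CubicalSet} (f : P.X ⟶ S) (g : Q.X ⟶ S)
    (h : P.tgt ≫ f = Q.src ≫ g)
    {Z : CubicalSet} (t : _ ⟶ Z) : inr P Q ≫ desc f g h ≫ t = g ≫ t := by
  rw [← Category.assoc, inr_desc]

lemma wedge_ext {P Q : Bip} {S : CubicalSet} {f g : (wedge P Q).X ⟶ S}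
    (hl : inl P Q ≫ f = inl P Q ≫ g) (hr : inr P Q ≫ f = inr P Q ≫ g) : f = g :=
  pushout.hom_ext hl hr

variable {P P' Q Q' R : Bip} {S : CubicalSet} {a b c d : cube 0 ⟶ S}

lemma wedge_hom_ext {f g : wedge P Q ⟶ R} (hl : inl P Q ≫ f.hom = inl P Q ≫ g.hom)
    (hr : inr P Q ≫ f.hom = inr P Q ≫ g.hom) : f = g :=
  hom_ext (wedge_ext hl hr)

/-- The concatenation `f * g : (P ∨ Q) → S_{a,c}` of `f : P → S_{a,b}` and `g : Q → S_{b,c}`. -/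
def conc (f : P ⟶ ⟨S, a, b⟩) (g : Q ⟶ ⟨S, b, c⟩) : wedge P Q ⟶ ⟨S, a, c⟩ :=
  ⟨desc f.hom g.hom (f.tgt.trans g.src.symm),
    by rw [← wedge_src, Category.assoc, inl_desc]; exact f.src,
    by rw [← wedge_tgt, Category.assoc, inr_desc]; exact g.tgt⟩

@[simp]
lemma inl_conc (f : P ⟶ ⟨S, a, b⟩) (g : Q ⟶ ⟨S, b, c⟩) :
    inl P Q ≫ (conc f g).hom = f.hom := inl_desc _ _ _

@[simp]
lemma inl_conc_assoc (f : P ⟶ ⟨S, a, b⟩) (g : Q ⟶ ⟨S, b, c⟩)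
    {Z : CubicalSet} (t : _ ⟶ Z) : inl P Q ≫ (conc f g).hom ≫ t = f.hom ≫ t := by
  rw [← Category.assoc, inl_conc]

@[simp]
lemma inr_conc (f : P ⟶ ⟨S, a, b⟩) (g : Q ⟶ ⟨S, b, c⟩) :
    inr P Q ≫ (conc f g).hom = g.hom := inr_desc _ _ _

@[simp]
lemma inr_conc_assoc (f : P ⟶ ⟨S, a, b⟩) (g : Q ⟶ ⟨S, b, c⟩)
    {Z : CubicalSet} (t : _ ⟶ Z) : inr P Q ≫ (conc f g).hom ≫ t = g.hom ≫ t := by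
  rw [← Category.assoc, inr_conc]

/-- The wedge sum `f ∨ g` of two maps. -/
def wmap (f : P ⟶ P') (g : Q ⟶ Q') : wedge P Q ⟶ wedge P' Q' :=
  ⟨desc (f.hom ≫ inl P' Q') (g.hom ≫ inr P' Q') (by
      rw [tgt_hom_assoc, src_hom_assoc, condition]),
    by rw [← wedge_src, Category.assoc, inl_desc, src_hom_assoc, wedge_src],
    by rw [← wedge_tgt, Category.assoc, inr_desc, tgt_hom_assoc, wedge_tgt]⟩

@[simp]
lemma inl_wmap (f : P ⟶ P') (g : Q ⟶ Q') :
    inl P Q ≫ (wmap f g).hom = f.hom ≫ inl P' Q' := inl_desc _ _ _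

@[simp]
lemma inl_wmap_assoc (f : P ⟶ P') (g : Q ⟶ Q')
    {Z : CubicalSet} (t : _ ⟶ Z) : inl P Q ≫ (wmap f g).hom ≫ t = f.hom ≫ inl P' Q' ≫ t := by
  rw [← Category.assoc, inl_wmap, Category.assoc]

@[simp]
lemma inr_wmap (f : P ⟶ P') (g : Q ⟶ Q') :
    inr P Q ≫ (wmap f g).hom = g.hom ≫ inr P' Q' := inr_desc _ _ _

@[simp]
lemma inr_wmap_assoc (f : P ⟶ P') (g : Q ⟶ Q')
    {Z : CubicalSet} (t : _ ⟶ Z) : inr P Q ≫ (wmap f g).hom ≫ t = g.hom ≫ inr P' Q' ≫ t := by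
  rw [← Category.assoc, inr_wmap, Category.assoc]

/-- The constant map at a point. -/
def const (a : cube 0 ⟶ S) : unit ⟶ ⟨S, a, a⟩ := ⟨a, Category.id_comp _, Category.id_comp _⟩

lemma wmap_conc (f : P ⟶ P') (g : Q ⟶ Q') (f' : P' ⟶ ⟨S, a, b⟩) (g' : Q' ⟶ ⟨S, b, c⟩) :
    wmap f g ≫ conc f' g' = conc (f ≫ f') (g ≫ g') := by
  apply wedge_hom_ext
  · rw [comp_hom, inl_wmap_assoc, inl_conc, inl_conc, comp_hom]
  · rw [comp_hom, inr_wmap_assoc, inr_conc, inr_conc, comp_hom]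

/-- A map of cubical sets as a map of double pointed cubical sets. -/
def mapOf {T : CubicalSet} {u v : cube 0 ⟶ T} (h : S ⟶ T) (ha : a ≫ h = u) (hb : b ≫ h = v) :
    (⟨S, a, b⟩ : Bip) ⟶ ⟨T, u, v⟩ := ⟨h, ha, hb⟩

lemma conc_comp {T : CubicalSet} {u v w : cube 0 ⟶ T} (f : P ⟶ ⟨S, a, b⟩) (g : Q ⟶ ⟨S, b, c⟩)
    (h : S ⟶ T) (ha : a ≫ h = u) (hb : b ≫ h = v) (hc : c ≫ h = w) :
    conc f g ≫ mapOf h ha hc = conc (f ≫ mapOf h ha hb) (g ≫ mapOf h hb hc) := by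
  apply wedge_hom_ext
  · rw [comp_hom, inl_conc_assoc, inl_conc]; rfl
  · rw [comp_hom, inr_conc_assoc, inr_conc]; rfl

/-- Every map out of a wedge is a concatenation. -/
lemma exists_conc (F : wedge P Q ⟶ ⟨S, a, c⟩) :
    ∃ (b : cube 0 ⟶ S) (f : P ⟶ ⟨S, a, b⟩) (g : Q ⟶ ⟨S, b, c⟩), F = conc f g := by
  refine ⟨P.tgt ≫ inl P Q ≫ F.hom, ⟨inl P Q ≫ F.hom, ?_, rfl⟩,
    ⟨inr P Q ≫ F.hom, ?_, ?_⟩, ?_⟩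
  · exact (wedge_src_assoc P Q _).trans F.src
  · exact (condition_assoc P Q _).symm
  · exact (wedge_tgt_assoc P Q _).trans F.tgt
  · apply wedge_hom_ext
    · rw [inl_conc]
    · rw [inr_conc]

/-- The right unit constraint of the wedge sum. -/
def rightUnit (P : Bip) : P ≅ wedge P unit where
  hom := ⟨inl P unit, rfl, condition P unit⟩
  inv := conc (S := P.X) (𝟙 P) (const P.tgt)
  hom_inv_id := hom_ext (inl_conc (S := P.X) (𝟙 P) (const P.tgt))
  inv_hom_id := by
    apply wedge_hom_ext
    · rw [comp_hom, inl_conc_assoc]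
      exact (Category.id_comp _).trans (Category.comp_id _).symm
    · rw [comp_hom, inr_conc_assoc]
      exact (condition P unit).trans ((Category.id_comp _).trans (Category.comp_id _).symm)

lemma rightUnit_conc (f : P ⟶ ⟨S, a, b⟩) : (rightUnit P).hom ≫ conc f (const b) = f :=
  hom_ext (inl_conc _ _)

/-- The left unit constraint of the wedge sum. -/
def leftUnit (P : Bip) : P ⟶ wedge unit P :=
  ⟨inr unit P, (condition unit P).symm.trans (Category.id_comp _), rfl⟩

lemma leftUnit_conc (f : P ⟶ ⟨S, a, b⟩) : leftUnit P ≫ conc (const a) f = f :=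
  hom_ext (inr_conc _ _)

/-- The associativity constraint of the wedge sum. -/
def wedgeAssoc (P Q R : Bip) : wedge (wedge P Q) R ≅ wedge P (wedge Q R) where
  hom := ⟨desc (desc (inl P (wedge Q R)) (inl Q R ≫ inr P (wedge Q R))
        (by rw [condition, ← wedge_src, Category.assoc]))
      (inr Q R ≫ inr P (wedge Q R))
      (by rw [← wedge_tgt, Category.assoc, inr_desc, condition_assoc]),
    by rw [← wedge_src, ← wedge_src, Category.assoc, Category.assoc, inl_desc, inl_desc, wedge_src],
    by rw [← wedge_tgt, Category.assoc, inr_desc, wedge_tgt_assoc, wedge_tgt]⟩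
  inv := ⟨desc (inl P Q ≫ inl (wedge P Q) R)
      (desc (inr P Q ≫ inl (wedge P Q) R) (inr (wedge P Q) R)
        (by rw [← condition, ← wedge_tgt, Category.assoc]))
      (by rw [← wedge_src, Category.assoc, inl_desc, condition_assoc]),
    by rw [← wedge_src, Category.assoc, inl_desc, wedge_src_assoc, wedge_src],
    by rw [← wedge_tgt, ← wedge_tgt, Category.assoc, Category.assoc, inr_desc, inr_desc, wedge_tgt]⟩
  hom_inv_id := by
    apply wedge_hom_ext
    · apply wedge_ext <;> simp
    · simp
  inv_hom_id := by
    apply wedge_hom_ext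
    · simp
    · apply wedge_ext <;> simp

lemma wedgeAssoc_conc (f : P ⟶ ⟨S, a, b⟩) (g : Q ⟶ ⟨S, b, c⟩) (h : R ⟶ ⟨S, c, d⟩) :
    (wedgeAssoc P Q R).hom ≫ conc f (conc g h) = conc (conc f g) h := by
  apply wedge_hom_ext
  · apply wedge_ext
    · simp only [wedgeAssoc, comp_hom, inl_desc_assoc, inl_conc]
    · simp only [wedgeAssoc, comp_hom, inl_desc_assoc, inr_desc_assoc, inl_conc, inr_conc,
        Category.assoc]
  · simp only [wedgeAssoc, comp_hom, inr_desc_assoc, inr_conc, Category.assoc]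

/-- The wedge sum of two isomorphisms. -/
def wedgeIso (e : P ≅ P') (e' : Q ≅ Q') : wedge P Q ≅ wedge P' Q' where
  hom := wmap e.hom e'.hom
  inv := wmap e.inv e'.inv
  hom_inv_id := by
    apply wedge_hom_ext
    · rw [comp_hom, inl_wmap_assoc, inl_wmap, ← comp_hom_assoc, e.hom_inv_id]; simp
    · rw [comp_hom, inr_wmap_assoc, inr_wmap, ← comp_hom_assoc, e'.hom_inv_id]; simp
  inv_hom_id := by
    apply wedge_hom_ext
    · rw [comp_hom, inl_wmap_assoc, inl_wmap, ← comp_hom_assoc, e.inv_hom_id]; simp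
    · rw [comp_hom, inr_wmap_assoc, inr_wmap, ← comp_hom_assoc, e'.inv_hom_id]; simp

end Bip

/-! ### The path category of a cubical set -/

namespace Path

open Bip

/-- The necklace `I_n`, concatenation of `n` copies of the `1`-cube. -/
def I : ℕ → Bip
  | 0 => unit
  | n + 1 => wedge (I n) (box 1)

/-- The isomorphism `I_{n+m} ≅ I_n ∨ I_m`. -/
def append (n : ℕ) : ∀ m : ℕ, I (n + m) ≅ wedge (I n) (I m)
  | 0 => rightUnit (I n)
  | m + 1 => wedgeIso (append n m) (Iso.refl _) ≪≫ wedgeAssoc (I n) (I m) (box 1)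

/-- A map of cubes, as a map of double pointed cubical sets. -/
def boxMap {n m : ℕ} (f : (⟨n⟩ : Box) ⟶ ⟨m⟩) {v w : Fin m → Bool}
    (hv : f.toFun (fun _ => false) = v) (hw : f.toFun (fun _ => true) = w) :
    box n ⟶ ⟨cube m, yoneda.map (Box.vertex v), yoneda.map (Box.vertex w)⟩ :=
  ⟨yoneda.map f, by subst hv; exact (yoneda.map_comp _ _).symm,
    by subst hw; exact (yoneda.map_comp _ _).symm⟩

/-- The path `∂_{1,0} * ∂_{2,1} : I_2 → □²`. -/
def sPath : I 2 ⟶ box 2 :=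
  conc (conc (const _) (boxMap (w := ![false, true]) (Box.δ 0 false) (by decide) (by decide)))
    (boxMap (Box.δ 1 true) (by decide) (by decide))

/-- The path `∂_{2,0} * ∂_{1,1} : I_2 → □²`. -/
def tPath : I 2 ⟶ box 2 :=
  conc (conc (const _) (boxMap (w := ![true, false]) (Box.δ 1 false) (by decide) (by decide)))
    (boxMap (Box.δ 0 true) (by decide) (by decide))

/-- The map `id ∨ p ∨ id : I_{k+2+j} → I_k ∨ □² ∨ I_j` for `p : I_2 → □²`. -/
def insert (p : I 2 ⟶ box 2) (k j : ℕ) : I (k + 2 + j) ⟶ wedge (wedge (I k) (box 2)) (I j) :=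
  (append (k + 2) j).hom ≫ wmap ((append k 2).hom ≫ wmap (𝟙 _) p) (𝟙 _)

variable {S T : CubicalSet}

/-- Paths `I_n → S_{a,b}` for varying `n`. -/
def RawPath (S : CubicalSet) (a b : cube 0 ⟶ S) : Type := Σ n : ℕ, (I n ⟶ ⟨S, a, b⟩)

/-- Factorisation of a path through another one. -/
def Factors {a b : cube 0 ⟶ S} (γ γ' : RawPath S a b) : Prop :=
  ∃ h : I γ.1 ⟶ I γ'.1, h ≫ γ'.2 = γ.2

/-- Paths joining `a` to `b`, up to the equivalence relation generated by factorisation. -/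
def PathClass (S : CubicalSet) (a b : cube 0 ⟶ S) : Type := Quot (Factors (a := a) (b := b))

/-- The class of a path. -/
def PathClass.mk {a b : cube 0 ⟶ S} {n : ℕ} (γ : I n ⟶ ⟨S, a, b⟩) : PathClass S a b :=
  Quot.mk _ ⟨n, γ⟩

lemma PathClass.mk_eq {a b : cube 0 ⟶ S} {n m : ℕ} {γ : I n ⟶ ⟨S, a, b⟩} {γ' : I m ⟶ ⟨S, a, b⟩}
    (h : I n ⟶ I m) (hh : h ≫ γ' = γ) : mk γ = mk γ' := Quot.sound ⟨h, hh⟩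

/-- Elementary steps between classes of paths, given by `2`-cubes: `[γ] ⇝ [γ']` if `γ` and `γ'`
are obtained from one map `I_k ∨ □² ∨ I_j → S_{a,b}`. -/
def Step {a b : cube 0 ⟶ S} (p p' : PathClass S a b) : Prop :=
  ∃ (k j : ℕ) (F : wedge (wedge (I k) (box 2)) (I j) ⟶ ⟨S, a, b⟩),
    p = .mk (insert sPath k j ≫ F) ∧ p' = .mk (insert tPath k j ≫ F)

/-- The preorder on classes of paths generated by elementary steps. -/
instance (a b : cube 0 ⟶ S) : Preorder (PathClass S a b) where
  le := Relation.ReflTransGen Step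
  le_refl _ := .refl
  le_trans _ _ _ := .trans

/-- Concatenation of paths. -/
def RawPath.comp {a b c : cube 0 ⟶ S} (γ : RawPath S a b) (β : RawPath S b c) : RawPath S a c :=
  ⟨γ.1 + β.1, (append γ.1 β.1).hom ≫ conc γ.2 β.2⟩

lemma Factors.comp {a b c : cube 0 ⟶ S} {γ γ' : RawPath S a b} {β β' : RawPath S b c}
    (h : Factors γ γ') (h' : Factors β β') : Factors (γ.comp β) (γ'.comp β') := by
  obtain ⟨h, hh⟩ := h
  obtain ⟨h', hh'⟩ := h'
  refine ⟨(append γ.1 β.1).hom ≫ wmap h h' ≫ (append γ'.1 β'.1).inv, ?_⟩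
  simp only [RawPath.comp, Category.assoc, Iso.inv_hom_id_assoc, wmap_conc, hh, hh']

lemma Factors.refl {a b : cube 0 ⟶ S} (γ : RawPath S a b) : Factors γ γ :=
  ⟨𝟙 _, Category.id_comp _⟩

namespace PathClass

/-- Concatenation of classes of paths. -/
def comp {a b c : cube 0 ⟶ S} (p : PathClass S a b) (q : PathClass S b c) : PathClass S a c :=
  Quot.map₂ RawPath.comp (fun γ _ _ h => (Factors.refl γ).comp h)
    (fun _ _ β h => h.comp (Factors.refl β)) p q

lemma mk_comp_mk {a b c : cube 0 ⟶ S} {n m : ℕ} (γ : I n ⟶ ⟨S, a, b⟩) (β : I m ⟶ ⟨S, b, c⟩) :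
    (mk γ).comp (mk β) = mk ((append n m).hom ≫ conc γ β) := rfl

lemma exists_mk {a b : cube 0 ⟶ S} (p : PathClass S a b) :
    ∃ (n : ℕ) (γ : I n ⟶ ⟨S, a, b⟩), p = mk γ := by
  induction p using Quot.ind with | _ γ => exact ⟨γ.1, γ.2, rfl⟩

/-- The class of the constant path. -/
def id (a : cube 0 ⟶ S) : PathClass S a a := mk (n := 0) (show I 0 ⟶ ⟨S, a, a⟩ from const a)

lemma comp_id {a b : cube 0 ⟶ S} (p : PathClass S a b) : p.comp (id b) = p := by
  obtain ⟨n, γ, rfl⟩ := p.exists_mk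
  exact congrArg (mk (n := n)) (rightUnit_conc γ)

lemma id_comp {a b : cube 0 ⟶ S} (p : PathClass S a b) : (id a).comp p = p := by
  obtain ⟨n, γ, rfl⟩ := p.exists_mk
  symm
  let L : I n ⟶ wedge (I 0) (I n) := leftUnit (I n)
  let e : I 0 ⟶ ⟨S, a, a⟩ := const a
  refine mk_eq (γ' := (append 0 n).hom ≫ conc e γ) (L ≫ (append 0 n).inv) ?_
  rw [Category.assoc, Iso.inv_hom_id_assoc]
  exact leftUnit_conc γ

lemma assoc {a b c d : cube 0 ⟶ S} (p : PathClass S a b) (q : PathClass S b c)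
    (r : PathClass S c d) : (p.comp q).comp r = p.comp (q.comp r) := by
  obtain ⟨n, γ, rfl⟩ := p.exists_mk
  obtain ⟨m, β, rfl⟩ := q.exists_mk
  obtain ⟨l, δ, rfl⟩ := r.exists_mk
  rw [mk_comp_mk, mk_comp_mk, mk_comp_mk, mk_comp_mk]
  refine mk_eq ((append (n + m) l).hom ≫ wmap (append n m).hom (𝟙 _) ≫ (wedgeAssoc _ _ _).hom ≫
    wmap (𝟙 _) (append m l).inv ≫ (append n (m + l)).inv) ?_
  simp only [Category.assoc, Iso.inv_hom_id_assoc, wmap_conc, Category.id_comp, wedgeAssoc_conc]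

/-- The action of a map of cubical sets on classes of paths. -/
def map {a b : cube 0 ⟶ S} {u v : cube 0 ⟶ T} (f : S ⟶ T) (ha : a ≫ f = u) (hb : b ≫ f = v)
    (p : PathClass S a b) : PathClass T u v :=
  Quot.map (fun γ => (⟨γ.1, γ.2 ≫ mapOf f ha hb⟩ : RawPath T u v))
    (fun γ γ' => by
      rintro ⟨h, hh⟩
      exact ⟨h, by rw [← hh, Category.assoc]⟩) p

lemma map_mk {a b : cube 0 ⟶ S} {u v : cube 0 ⟶ T} (f : S ⟶ T) (ha : a ≫ f = u) (hb : b ≫ f = v)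
    {n : ℕ} (γ : I n ⟶ ⟨S, a, b⟩) : map f ha hb (mk γ) = mk (γ ≫ mapOf f ha hb) := rfl

lemma map_id {a : cube 0 ⟶ S} {u : cube 0 ⟶ T} (f : S ⟶ T) (ha : a ≫ f = u) :
    map f ha ha (id a) = id u := by
  subst ha; rfl

lemma map_comp {a b c : cube 0 ⟶ S} {u v w : cube 0 ⟶ T} (f : S ⟶ T) (ha : a ≫ f = u)
    (hb : b ≫ f = v) (hc : c ≫ f = w) (p : PathClass S a b) (q : PathClass S b c) :
    map f ha hc (p.comp q) = (map f ha hb p).comp (map f hb hc q) := by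
  obtain ⟨n, γ, rfl⟩ := p.exists_mk
  obtain ⟨m, β, rfl⟩ := q.exists_mk
  simp only [mk_comp_mk, map_mk, Category.assoc, conc_comp γ β f ha hb hc]

lemma map_mono {a b : cube 0 ⟶ S} {u v : cube 0 ⟶ T} (f : S ⟶ T) (ha : a ≫ f = u)
    (hb : b ≫ f = v) {p p' : PathClass S a b} (h : p ≤ p') : map f ha hb p ≤ map f ha hb p' := by
  refine Relation.ReflTransGen.lift (map f ha hb) ?_ _ _ h
  rintro _ _ ⟨k, j, F, rfl, rfl⟩
  exact ⟨k, j, F ≫ mapOf f ha hb, by simp only [map_mk, Category.assoc],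
    by simp only [map_mk, Category.assoc]⟩

lemma mk_insert {a b c d : cube 0 ⟶ S} (p : I 2 ⟶ box 2) {k j : ℕ} (u : I k ⟶ ⟨S, a, b⟩)
    (q : box 2 ⟶ ⟨S, b, c⟩) (v : I j ⟶ ⟨S, c, d⟩) :
    mk (insert p k j ≫ conc (conc u q) v) = ((mk u).comp (mk (p ≫ q))).comp (mk v) := by
  simp only [mk_comp_mk, insert, Category.assoc, wmap_conc, Category.id_comp]

lemma step_iff {a b : cube 0 ⟶ S} (p p' : PathClass S a b) :
    Step p p' ↔ ∃ (c d : cube 0 ⟶ S) (u : PathClass S a c) (q : box 2 ⟶ ⟨S, c, d⟩)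
      (v : PathClass S d b), p = (u.comp (mk (sPath ≫ q))).comp v ∧
        p' = (u.comp (mk (tPath ≫ q))).comp v := by
  constructor
  · rintro ⟨k, j, F, rfl, rfl⟩
    obtain ⟨d, F', v, rfl⟩ := exists_conc F
    obtain ⟨c, u, q, rfl⟩ := exists_conc F'
    exact ⟨c, d, mk u, q, mk v, mk_insert _ _ _ _, mk_insert _ _ _ _⟩
  · rintro ⟨c, d, u, q, v, rfl, rfl⟩
    obtain ⟨k, u, rfl⟩ := u.exists_mk
    obtain ⟨j, v, rfl⟩ := v.exists_mk
    exact ⟨k, j, conc (conc u q) v, (mk_insert _ _ _ _).symm, (mk_insert _ _ _ _).symm⟩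

lemma comp_mono {a b c : cube 0 ⟶ S} {p p' : PathClass S a b} {q q' : PathClass S b c}
    (hp : p ≤ p') (hq : q ≤ q') : p.comp q ≤ p'.comp q' := by
  have h1 : p.comp q ≤ p'.comp q := by
    refine Relation.ReflTransGen.lift (fun r : PathClass S a b => r.comp q) ?_ _ _ hp
    intro r r' h
    obtain ⟨c, d, u, f, v, rfl, rfl⟩ := (step_iff _ _).1 h
    exact (step_iff _ _).2 ⟨c, d, u, f, v.comp q, assoc _ _ _, assoc _ _ _⟩
  have h2 : p'.comp q ≤ p'.comp q' := by
    refine Relation.ReflTransGen.lift (fun r : PathClass S b c => p'.comp r) ?_ _ _ hq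
    intro r r' h
    obtain ⟨c, d, u, f, v, rfl, rfl⟩ := (step_iff _ _).1 h
    exact (step_iff _ _).2 ⟨c, d, p'.comp u, f, v, by simp only [assoc], by simp only [assoc]⟩
  exact h1.trans h2

end PathClass

end Path

/-! ### Categories enriched in preordered sets and their nerves -/

/-- A small category enriched in preordered sets. -/
structure ProsetCat : Type 1 where
  Obj : Type
  [category : SmallCategory Obj]
  [preorder : ∀ x y : Obj, Preorder (x ⟶ y)]
  comp_le_comp : ∀ {x y z : Obj} {f f' : x ⟶ y} {g g' : y ⟶ z},
    f ≤ f' → g ≤ g' → f ≫ g ≤ f' ≫ g'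

namespace ProsetCat

attribute [instance] category preorder

/-- Functors that are order preserving on morphisms. -/
@[ext]
structure Hom (C D : ProsetCat) : Type where
  functor : C.Obj ⥤ D.Obj
  monotone : ∀ {x y : C.Obj} {f g : x ⟶ y}, f ≤ g → functor.map f ≤ functor.map g

instance : Category ProsetCat where
  Hom := Hom
  id C := ⟨𝟭 _, fun h => h⟩
  comp F G := ⟨F.functor ⋙ G.functor, fun h => G.monotone (F.monotone h)⟩

/-- The levelwise composition on nerves of preorders of morphisms. -/
def nerveComp (C : ProsetCat) {k : SimplexCategoryᵒᵖ} {x y z : C.Obj}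
    (f : (nerve (x ⟶ y)).obj k) (g : (nerve (y ⟶ z)).obj k) : (nerve (x ⟶ z)).obj k where
  obj i := f.obj i ≫ g.obj i
  map φ := homOfLE (C.comp_le_comp (leOfHom (f.map φ)) (leOfHom (g.map φ)))

/-- The nerve of a category enriched in preordered sets: take the nerve of each preordered set
of morphisms. -/
def nerveObj (C : ProsetCat) : SCat where
  Obj := C.Obj
  enriched := SCat.mkEnriched C.Obj (fun x y => nerve (x ⟶ y))
    (fun _ x => (Functor.const _).obj (𝟙 x))
    (fun f g => C.nerveComp f g)
    (fun _ _ => rfl)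
    (fun _ _ _ _ _ _ => rfl)
    (fun f => nerve.ext_of_isThin (funext fun i => Category.id_comp (f.obj i)))
    (fun f => nerve.ext_of_isThin (funext fun i => Category.comp_id (f.obj i)))
    (fun f g h => nerve.ext_of_isThin
      (funext fun i => Category.assoc (f.obj i) (g.obj i) (h.obj i)))

/-- The nerve on morphisms. -/
def nerveMap {C D : ProsetCat} (F : C ⟶ D) : C.nerveObj ⟶ D.nerveObj :=
  SCat.mkFunctor (C := C.nerveObj) (D := D.nerveObj) F.functor.obj
    (fun {k x y} (f : (nerve (C := (show C.Obj from x) ⟶ (show C.Obj from y))).obj k) =>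
      (show (nerve (C := F.functor.obj x ⟶ F.functor.obj y)).obj k from
        f ⋙ Monotone.functor (f := fun g => F.functor.map g) fun _ _ h => F.monotone h))
    (fun _ _ _ _ => rfl)
    (fun _ x => nerve.ext_of_isThin (funext fun _ => F.functor.map_id x))
    (fun _ _ => nerve.ext_of_isThin (funext fun _ => F.functor.map_comp _ _))

/-- The nerve functor from categories enriched in preordered sets to simplicial categories. -/
def nerveFunctor : ProsetCat ⥤ SCat where
  obj := nerveObj
  map := nerveMap
  map_id _ := rfl
  map_comp _ _ := rfl

end ProsetCat

/-- The category enriched in preordered sets of paths in a cubical set. -/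
def pathCatObj (S : CubicalSet) : ProsetCat where
  Obj := S.Vertex
  category :=
    { Hom a b := Path.PathClass S (CubicalSet.pt a) (CubicalSet.pt b)
      id _ := .id _
      comp p q := p.comp q
      id_comp := Path.PathClass.id_comp
      comp_id := Path.PathClass.comp_id
      assoc := Path.PathClass.assoc }
  preorder a b := inferInstanceAs (Preorder (Path.PathClass S (CubicalSet.pt a) (CubicalSet.pt b)))
  comp_le_comp hf hg := Path.PathClass.comp_mono hf hg

/-- The path category functor on morphisms. -/
def pathCatMap {S T : CubicalSet} (f : S ⟶ T) : pathCatObj S ⟶ pathCatObj T where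
  functor :=
    { obj a := f.app _ a
      map {a b} p := Path.PathClass.map f (CubicalSet.pt_comp a f) (CubicalSet.pt_comp b f) p
      map_id _ := Path.PathClass.map_id _ _
      map_comp _ _ := Path.PathClass.map_comp _ _ _ _ _ _ }
  monotone h := Path.PathClass.map_mono _ _ _ h

/-- The path category functor from cubical sets to categories enriched in preordered sets. -/
def pathCat : CubicalSet ⥤ ProsetCat where
  obj := pathCatObj
  map := pathCatMap
  map_id S := by
    refine ProsetCat.Hom.ext (CategoryTheory.Functor.hext (fun _ => rfl) fun _ _ p => heq_of_eq ?_)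
    obtain ⟨n, γ, rfl⟩ := Path.PathClass.exists_mk p
    exact congrArg Path.PathClass.mk (Category.comp_id γ)
  map_comp f g := by
    refine ProsetCat.Hom.ext (CategoryTheory.Functor.hext (fun _ => rfl) fun _ _ p => heq_of_eq ?_)
    obtain ⟨n, γ, rfl⟩ := Path.PathClass.exists_mk p
    exact congrArg Path.PathClass.mk (Bip.hom_ext (Category.assoc _ _ _).symm)

/-! ### Rigidification -/

/-- The simplicial categories associated with the cubes. -/
def cubeRigidification : Box ⥤ SCat := yoneda ⋙ pathCat ⋙ ProsetCat.nerveFunctor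

/-- The rigidification functor, the left Kan extension of `cubeRigidification` along the
Yoneda embedding. -/
def rigidification : CubicalSet ⥤ SCat :=
  (yoneda : Box ⥤ CubicalSet).leftKanExtension cubeRigidification

/-- The unit of the left Kan extension. -/
def rigidificationUnit : cubeRigidification ⟶ yoneda ⋙ rigidification :=
  (yoneda : Box ⥤ CubicalSet).leftKanExtensionUnit cubeRigidification

/-- Double pointed simplicial categories. -/
structure BiSCat : Type 1 where
  C : SCat
  src : C.Obj
  tgt : C.Obj

namespace BiSCat

/-- Simplicial functors preserving the two distinguished objects. -/
@[ext]
structure Hom (C D : BiSCat) : Type where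
  functor : C.C ⟶ D.C
  src : functor.obj C.src = D.src
  tgt : functor.obj C.tgt = D.tgt

instance : Category BiSCat where
  Hom := Hom
  id C := ⟨𝟙 C.C, rfl, rfl⟩
  comp F G := ⟨F.functor ≫ G.functor, (congrArg G.functor.obj F.src).trans G.src,
    (congrArg G.functor.obj F.tgt).trans G.tgt⟩

lemma eqToHom_map {C D : SCat} (F : C ⟶ D) {x y x' y' : C.Obj} (hx : x = x') (hy : y = y') :
    eqToHom (congrArg₂ C.hom hx hy) ≫ F.map x' y' =
      F.map x y ≫ eqToHom (congrArg₂ D.hom (congrArg F.obj hx) (congrArg F.obj hy)) := by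
  subst hx hy
  exact (Category.id_comp _).trans (Category.comp_id _).symm

/-- The mapping space between the two distinguished objects, as a functor. -/
def homFunctor : BiSCat ⥤ SSet.{0} where
  obj C := C.C.hom C.src C.tgt
  map {C D} F := F.functor.map C.src C.tgt ≫
    eqToHom (congrArg₂ D.C.hom F.src F.tgt)
  map_id C := by
    exact Category.comp_id _
  map_comp {C D E} F G := by
    refine Eq.trans ?_ (Category.assoc _ _ _).symm
    refine Eq.trans ?_ (congrArg (fun t => F.functor.map C.src C.tgt ≫ t)
      ((Category.assoc _ _ _).symm.trans
        ((congrArg (fun t => t ≫ eqToHom (congrArg₂ E.C.hom G.src G.tgt))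
          (eqToHom_map G.functor F.src F.tgt)).trans
          ((Category.assoc _ _ _).trans (congrArg (fun t => G.functor.map _ _ ≫ t)
            (eqToHom_trans _ _)))))).symm
    exact Category.assoc _ _ _

end BiSCat

/-- The object of the rigidification corresponding to a vertex `a : □⁰ → S`: the image under the
simplicial functor induced by `a` of the unique vertex of the `0`-cube. -/
def rigidVertex {S : CubicalSet} (a : cube 0 ⟶ S) : (rigidification.obj S).Obj :=
  (rigidification.map a).obj ((rigidificationUnit.app ⟨0⟩).obj (𝟙 (⟨0⟩ : Box)))

lemma rigidVertex_comp {S T : CubicalSet} (a : cube 0 ⟶ S) (f : S ⟶ T) :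
    (rigidification.map f).obj (rigidVertex a) = rigidVertex (a ≫ f) :=
  (congrArg (fun G : rigidification.obj (cube 0) ⟶ rigidification.obj T =>
    G.obj ((rigidificationUnit.app ⟨0⟩).obj (𝟙 (⟨0⟩ : Box))))
    (rigidification.map_comp a f)).symm

/-- The rigidification functor on double pointed cubical sets. -/
def rigidificationBip : Bip ⥤ BiSCat where
  obj P := ⟨rigidification.obj P.X, rigidVertex P.src, rigidVertex P.tgt⟩
  map f := ⟨rigidification.map f.hom,
    (rigidVertex_comp _ _).trans (congrArg rigidVertex f.src),
    (rigidVertex_comp _ _).trans (congrArg rigidVertex f.tgt)⟩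
  map_id _ := BiSCat.Hom.ext (rigidification.map_id _)
  map_comp _ _ := BiSCat.Hom.ext (rigidification.map_comp _ _)

/-- The functor sending `S_{a,b}` to the mapping space from `a` to `b` in the rigidification
of `S`. -/
def rigidHom : Bip ⥤ SSet.{0} := rigidificationBip ⋙ BiSCat.homFunctor

lemma rigidHom_obj (S : CubicalSet) (a b : cube 0 ⟶ S) :
    rigidHom.obj ⟨S, a, b⟩ = (rigidification.obj S).hom (rigidVertex a) (rigidVertex b) := rfl

/-! ### Necklaces -/

/-- The necklace `□^{n_1} ∨ ⋯ ∨ □^{n_k}` associated with a sequence of positive integers. -/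
def neck : List ℕ+ → Bip
  | [] => Bip.unit
  | n :: l => Bip.wedge (Bip.box n) (neck l)

/-- The category of necklaces, a full subcategory of double pointed cubical sets. -/
abbrev Nec : Type := InducedCategory Bip neck

/-- The inclusion of necklaces in double pointed cubical sets. -/
abbrev necIncl : Nec ⥤ Bip := inducedFunctor neck

/-- The category of necklaces over a double pointed cubical set. -/
abbrev NecOver (P : Bip) : Type := CostructuredArrow necIncl P

/-- The category of monomorphic necklaces over a double pointed cubical set. It is a full
subcategory of the category of necklaces over `P`, since any morphism over `P` between such
necklaces is a monomorphism. There is at most one morphism between two objects. -/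
abbrev SubNeck (P : Bip) : Type :=
  ObjectProperty.FullSubcategory fun f : NecOver P => Mono f.hom.hom

/-- Morphisms of monomorphic necklaces are monomorphisms of cubical sets. -/
lemma SubNeck.mono {P : Bip} {f g : SubNeck P} (φ : f ⟶ g) :
    Mono (necIncl.map φ.hom.left).hom := by
  have hf : Mono f.obj.hom.hom := f.property
  have h := congrArg Bip.Hom.hom (CostructuredArrow.w φ.hom)
  rw [← h] at hf
  exact mono_of_mono (necIncl.map φ.hom.left).hom g.obj.hom.hom

/-- Monomorphic necklaces over `P` form a preordered set. -/
instance SubNeck.isThin (P : Bip) : Quiver.IsThin (SubNeck P) := fun f g => ⟨fun φ ψ => by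
  have hg : Mono g.obj.hom.hom := g.property
  have h := congrArg Bip.Hom.hom
    ((CostructuredArrow.w φ.hom).trans (CostructuredArrow.w ψ.hom).symm)
  have h' : (necIncl.map φ.hom.left).hom = (necIncl.map ψ.hom.left).hom :=
    (cancel_mono g.obj.hom.hom).1 h
  apply ObjectProperty.hom_ext
  apply CostructuredArrow.hom_ext
  exact necIncl.map_injective (Bip.hom_ext h')⟩

/-- The inclusion of monomorphic necklaces in all necklaces over `P`. -/
abbrev subNeckIncl (P : Bip) : SubNeck P ⥤ NecOver P := ObjectProperty.ι _

/-- The diagram of mapping spaces of the monomorphic necklaces over `P`. -/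
abbrev subNeckDiagram (P : Bip) : SubNeck P ⥤ SSet.{0} :=
  subNeckIncl P ⋙ CostructuredArrow.proj necIncl P ⋙ necIncl ⋙ rigidHom

/-- The cocone of the diagram of mapping spaces induced by the maps `T → P`. -/
def subNeckCocone (P : Bip) : Cocone (subNeckDiagram P) where
  pt := rigidHom.obj P
  ι :=
    { app f := rigidHom.map f.obj.hom
      naturality f g φ := by
        have h := CostructuredArrow.w ((subNeckIncl P).map φ)
        exact (rigidHom.map_comp _ _).symm.trans
          ((congrArg (fun ψ => rigidHom.map ψ) h).trans (Category.comp_id _).symm) }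

end CubicalRigidification

end

open CubicalRigidification

open CategoryTheory Limits MonoidalCategory Opposite

noncomputable section

namespace CubicalRigidification

/-! The theorem splits into two independent statements.

Finality. Every map of cubes is a split epimorphism fixing the extremal vertices followed by the
inclusion of an interval, which is a split monomorphism (`Box.IsBoxMap.exists_factorization`, proved
through a normal form). Hence a cube mapped to a cubical subset `S` of a cube has a cube as image.
For a necklace the images of the beads are again concatenated injectively: maps out of necklaces are
bounded by the images of their two points (`Bip.Bounded`), so consecutive beads can meet only in
their common vertex (`Bip.mono_conc`). Thus every map from a necklace to `S` factors as an
epimorphism onto a necklace followed by a monomorphism (`Bip.exists_image_neck`). Such a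
factorisation is a weakly initial object of the comma category that has to be connected, because
epimorphisms of presheaves lift against monomorphisms.

Colimit over all necklaces, valid for every double pointed cubical set `P`. The colimits of the
mapping spaces of necklaces over `S_{a,b}` are the mapping spaces of a simplicial category `neckCat
S`, with concatenation as composition, and evaluation gives a transformation `neckComparison` to the
rigidification. Conversely, a simplex from `u` to `v` in a cube lives on the interval between `u`
and `v`, a necklace with one bead (or none), which gives `cubeToNeck`. The universal property of the
Kan extension extends it to `rigidToNeck`, a section of `neckComparison`. Over a necklace `P`, the
class assigned to a simplex is represented by some map of necklaces `g : T → P` whose evaluation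
returns the simplex, so `g` itself identifies that class with the tautological one
(`RigidSimplex.toNeck_of_isNeck`). By naturality the section is a two-sided inverse on mapping
spaces.

Finality then restricts the colimit to monomorphic necklaces. -/

/-! ### Factorisation of maps of cubes -/

namespace Box

/-- The map `f` acting on all coordinates but the first one. -/
def lift {m n : ℕ} (f : (Fin m → Bool) → (Fin n → Bool)) (x : Fin (m + 1) → Bool) :
    Fin (n + 1) → Bool :=
  Fin.cons (x 0) (f (Fin.tail x))

@[simp]
lemma lift_zero {m n : ℕ} (f : (Fin m → Bool) → (Fin n → Bool)) (x : Fin (m + 1) → Bool) :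
    lift f x 0 = x 0 := rfl

@[simp]
lemma lift_succ {m n : ℕ} (f : (Fin m → Bool) → (Fin n → Bool)) (x : Fin (m + 1) → Bool)
    (j : Fin n) : lift f x j.succ = f (Fin.tail x) j := rfl

lemma lift_comp {l m n : ℕ} (f : (Fin l → Bool) → (Fin m → Bool))
    (g : (Fin m → Bool) → (Fin n → Bool)) (x : Fin (l + 1) → Bool) :
    lift g (lift f x) = lift (fun y => g (f y)) x := rfl

lemma lift_id {m : ℕ} (x : Fin (m + 1) → Bool) : lift (fun y : Fin m → Bool => y) x = x :=
  Fin.cons_self_tail x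

lemma face_zero {n : ℕ} (ε : Bool) (x : Fin n → Bool) : face 0 ε x = Fin.cons ε x := by
  funext j
  refine Fin.cases ?_ (fun j => ?_) j <;> simp [face]

/-- With `degen_succ` and `conn_succ`, this reduces inductions over the generators to those of index
zero. -/
lemma face_succ {n : ℕ} (i : Fin (n + 1)) (ε : Bool) : face i.succ ε = lift (face i ε) := by
  funext x j
  refine Fin.cases ?_ (fun j => ?_) j
  · simp only [face, lift_zero]
    have h := Fin.insertNth_apply_succAbove (α := fun _ => Bool) i.succ ε x 0
    rwa [Fin.succ_succAbove_zero] at h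
  · simp only [face, lift_succ]
    refine Fin.succAboveCases i ?_ (fun k => ?_) j
    · rw [Fin.insertNth_apply_same, Fin.insertNth_apply_same]
    · rw [Fin.insertNth_apply_succAbove, ← Fin.succ_succAbove_succ,
        Fin.insertNth_apply_succAbove]
      rfl

lemma degen_zero {n : ℕ} : (degen 0 : (Fin (n + 1) → Bool) → _) = Fin.tail := by
  funext x j
  simp [degen, Fin.tail]

lemma degen_succ {n : ℕ} (i : Fin (n + 1)) : degen i.succ = lift (degen i) := by
  funext x j
  refine Fin.cases ?_ (fun j => ?_) j
  · simp [degen]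
  · simp [degen, Fin.tail]

lemma conn_succ {n : ℕ} (i : Fin n) : conn i.succ = lift (conn i) := by
  funext x j
  refine Fin.cases ?_ (fun j => ?_) j
  · simp [conn]
  · simp [conn, Fin.tail]

lemma conn_zero {n : ℕ} (x : Fin (n + 2) → Bool) :
    conn 0 x = Fin.cons (max (x 0) (x 1)) (Fin.tail (Fin.tail x)) := by
  funext j
  refine Fin.cases ?_ (fun j => ?_) j
  · simp [conn]
  · simp [conn, Fin.tail]

lemma IsBoxMap.lift {m n : ℕ} {f : (Fin m → Bool) → (Fin n → Bool)} (hf : IsBoxMap f) :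
    IsBoxMap (lift f) := by
  induction hf with
  | id n =>
    have : Box.lift (fun x : Fin n → Bool => x) = fun x => x := funext lift_id
    rw [this]; exact .id _
  | @comp l m n f g _ _ hf hg => exact .comp (f := Box.lift f) (g := Box.lift g) hf hg
  | face i ε => rw [← face_succ]; exact .face _ _
  | degen i => rw [← degen_succ]; exact .degen _
  | conn i => rw [← conn_succ]; exact .conn _

lemma isBoxMap_cons {n : ℕ} (ε : Bool) :
    IsBoxMap (fun x : Fin n → Bool => (Fin.cons ε x : Fin (n + 1) → Bool)) := by
  have : (fun x : Fin n → Bool => (Fin.cons ε x : Fin (n + 1) → Bool)) = face 0 ε :=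
    funext fun x => (face_zero ε x).symm
  rw [this]; exact .face _ _

lemma isBoxMap_tail {n : ℕ} :
    IsBoxMap (fun x : Fin (n + 1) → Bool => Fin.tail x) := by
  have : (fun x : Fin (n + 1) → Bool => Fin.tail x) = degen 0 := degen_zero.symm
  rw [this]; exact .degen _

lemma IsBoxMap.monotone {m n : ℕ} {f : (Fin m → Bool) → (Fin n → Bool)} (hf : IsBoxMap f) :
    Monotone f := by
  induction hf with
  | id n => exact monotone_id
  | comp _ _ hf hg => exact hg.comp hf
  | face i ε =>
    intro x y h j
    refine Fin.succAboveCases i ?_ (fun k => ?_) j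
    · simp [Box.face]
    · simpa [Box.face] using h k
  | degen i => exact fun x y h j => h _
  | conn i =>
    intro x y h j
    simp only [Box.conn]
    split_ifs
    · exact h _
    · exact max_le_max (h _) (h _)
    · exact h _

/-! ### Normal forms of maps of cubes -/

/-- The degeneracies and the connections, described recursively. -/
inductive IsEpiGen : ∀ {m n : ℕ}, ((Fin m → Bool) → (Fin n → Bool)) → Prop
  | tail (n : ℕ) : IsEpiGen (fun x : Fin (n + 1) → Bool => (Fin.tail x : Fin n → Bool))
  | conn (n : ℕ) : IsEpiGen (Box.conn (0 : Fin (n + 1)))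
  | lift {m n : ℕ} {f : (Fin m → Bool) → (Fin n → Bool)} (hf : IsEpiGen f) : IsEpiGen (lift f)

/-- A normal form of the maps of cubes. -/
inductive IsNormal : ∀ {m n : ℕ}, ((Fin m → Bool) → (Fin n → Bool)) → Prop
  | nil : IsNormal (fun x : Fin 0 → Bool => x)
  | cons {m n : ℕ} {f : (Fin m → Bool) → (Fin n → Bool)} (ε : Bool) (hf : IsNormal f) :
      IsNormal (fun x => (Fin.cons ε (f x) : Fin (n + 1) → Bool))
  | lift {m n : ℕ} {f : (Fin m → Bool) → (Fin n → Bool)} (hf : IsNormal f) : IsNormal (lift f)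
  | pre {l m n : ℕ} {g : (Fin l → Bool) → (Fin m → Bool)} {f : (Fin m → Bool) → (Fin n → Bool)}
      (hg : IsEpiGen g) (hf : IsNormal f) : IsNormal (fun x => f (g x))

lemma isEpiGen_degen {n : ℕ} (i : Fin (n + 1)) : IsEpiGen (degen i) := by
  induction n with
  | zero =>
    obtain rfl : i = 0 := Fin.eq_zero i
    rw [degen_zero]; exact .tail _
  | succ n ih =>
    refine Fin.cases ?_ (fun i => ?_) i
    · rw [degen_zero]; exact .tail _
    · rw [degen_succ]; exact .lift (ih i)

lemma isEpiGen_conn {n : ℕ} (i : Fin n) : IsEpiGen (conn i) := by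
  induction n with
  | zero => exact i.elim0
  | succ n ih =>
    refine Fin.cases ?_ (fun i => ?_) i
    · exact .conn _
    · rw [conn_succ]; exact .lift (ih i)

lemma IsNormal.id (n : ℕ) : IsNormal (fun x : Fin n → Bool => x) := by
  induction n with
  | zero => exact .nil
  | succ n ih =>
    have : Box.lift (fun x : Fin n → Bool => x) = fun x => x := funext lift_id
    rw [← this]; exact .lift ih

lemma IsNormal.of_eq {m n : ℕ} {f g : (Fin m → Bool) → (Fin n → Bool)} (hf : IsNormal f)
    (h : ∀ x, g x = f x) : IsNormal g := by
  rwa [funext h]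

lemma IsNormal.tail {m n : ℕ} {f : (Fin m → Bool) → (Fin (n + 1) → Bool)} (hf : IsNormal f) :
    IsNormal (fun x => Fin.tail (f x)) := by
  -- Induction on `IsNormal` needs a variable codomain dimension `k`; the equation `k = n + 1` is
  -- carried along and `Fin.cast` repairs the types.
  have key : ∀ {m k : ℕ} {f : (Fin m → Bool) → (Fin k → Bool)}, IsNormal f →
      ∀ (n : ℕ) (h : k = n + 1), IsNormal (fun x (j : Fin n) => f x (Fin.cast h.symm j.succ)) := by
    intro m k f hf
    induction hf with
    | nil => intro n h; exact absurd h (by omega)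
    | cons ε hf ih =>
      intro n h
      cases h
      exact hf
    | lift hf ih =>
      intro n h
      cases h
      exact .pre (.tail _) hf
    | pre hg hf ih =>
      intro n h
      exact .pre hg (ih n h)
  exact key hf n rfl

lemma conn_cons_false {n : ℕ} (x : Fin (n + 1) → Bool) : conn 0 (Fin.cons false x) = x := by
  rw [conn_zero]
  refine Eq.trans ?_ (Fin.cons_self_tail x)
  simp

lemma conn_cons_true {n : ℕ} (x : Fin (n + 1) → Bool) :
    conn 0 (Fin.cons true x) = Fin.cons true (Fin.tail x) := by
  rw [conn_zero]
  simp

/-- The connection merges the free first coordinate with the first coordinate of `f`. If the latter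
is constantly false, the connection disappears; if constantly true, it absorbs the free coordinate,
which is then forgotten; if it is free as well, the connection moves to the source. -/
lemma IsNormal.conn_lift {m n : ℕ} {f : (Fin m → Bool) → (Fin (n + 1) → Bool)} (hf : IsNormal f) :
    IsNormal (fun x => Box.conn 0 (Box.lift f x)) := by
  have key : ∀ {m k : ℕ} {f : (Fin m → Bool) → (Fin k → Bool)}, IsNormal f →
      ∀ (n : ℕ) (h : k = n + 1), IsNormal
        (fun x => Box.conn 0 (Box.lift (fun y (j : Fin (n + 1)) => f y (Fin.cast h.symm j)) x)) := by
    intro m k f hf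
    induction hf with
    | nil => intro n h; exact absurd h (by omega)
    | @cons m n f ε hf ih =>
      intro n h
      cases h
      cases ε with
      | false =>
        refine (IsNormal.lift hf).of_eq fun x => ?_
        rw [conn_zero]
        simp [Box.lift, Fin.tail_def]
      | true =>
        refine (IsNormal.cons true (IsNormal.pre (.tail _) hf)).of_eq fun x => ?_
        rw [conn_zero]
        simp [Box.lift, Fin.tail_def]
    | @lift m n f hf ih =>
      intro n h
      cases h
      refine (IsNormal.pre (.conn _) (IsNormal.lift hf)).of_eq fun x => ?_
      rw [conn_zero, conn_zero]
      rfl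
    | @pre l m k g f hg hf ih =>
      intro n h
      exact .pre (g := Box.lift g) (.lift hg) (ih n h)
  exact key hf n rfl

lemma IsNormal.post_epi {l m n : ℕ} {f : (Fin l → Bool) → (Fin m → Bool)}
    {g : (Fin m → Bool) → (Fin n → Bool)} (hf : IsNormal f) (hg : IsEpiGen g) :
    IsNormal (fun x => g (f x)) := by
  induction hf generalizing n with
  | nil => cases hg
  | cons ε hf ih =>
    cases hg with
    | tail => exact hf
    | conn =>
      cases ε with
      | false => simpa only [conn_cons_false] using hf
      | true => simpa only [conn_cons_true] using .cons true hf.tail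
    | lift hg => exact .cons ε (ih hg)
  | @lift m n f hf ih =>
    cases hg with
    | tail => exact .pre (f := f) (.tail _) hf
    | conn => exact hf.conn_lift
    | lift hg => exact .lift (ih hg)
  | @pre l m n g' f hg' hf ih => exact .pre (g := g') hg' (ih hg)

lemma IsNormal.post_face {l m : ℕ} {f : (Fin l → Bool) → (Fin m → Bool)} (hf : IsNormal f)
    (i : Fin (m + 1)) (ε : Bool) : IsNormal (fun x => Box.face i ε (f x)) := by
  induction hf with
  | nil =>
    obtain rfl : i = 0 := Fin.eq_zero i
    simpa only [face_zero] using .cons ε .nil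
  | @cons m n f ε' hf ih =>
    refine Fin.cases ?_ (fun i => ?_) i
    · simpa only [face_zero] using .cons ε (.cons ε' hf)
    · simpa only [face_succ] using .cons ε' (ih i)
  | @lift m n f hf ih =>
    refine Fin.cases ?_ (fun i => ?_) i
    · simpa only [face_zero] using .cons ε (.lift hf)
    · simpa only [face_succ] using .lift (ih i)
  | @pre l m n g f hg hf ih => exact .pre (g := g) hg (ih i)

lemma IsBoxMap.isNormal {m n : ℕ} {g : (Fin m → Bool) → (Fin n → Bool)} (hg : IsBoxMap g) :
    IsNormal g := by
  -- Closure under postcomposition passes through composites of generators, whereas normality of `g`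
  -- alone would not; it is applied to the identity at the end.
  have key : ∀ {m n : ℕ} {g : (Fin m → Bool) → (Fin n → Bool)}, IsBoxMap g →
      ∀ {l : ℕ} {f : (Fin l → Bool) → (Fin m → Bool)}, IsNormal f →
        IsNormal (fun x => g (f x)) := by
    intro m n g hg
    induction hg with
    | id n => exact fun hf => hf
    | comp _ _ h h' => exact fun hf => h' (h hf)
    | face i ε => exact fun hf => hf.post_face i ε
    | degen i => exact fun hf => hf.post_epi (isEpiGen_degen i)
    | conn i => exact fun hf => hf.post_epi (isEpiGen_conn i)
  exact key hg (.id m)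

/-! ### Intervals and the factorisation of maps of cubes -/

/-- `ι` is the inclusion of an interval of `[1]^n` and `r` is a retraction of `ι`, both in the cube
category. -/
structure IsInterval {p n : ℕ} (ι : (Fin p → Bool) → (Fin n → Bool))
    (r : (Fin n → Bool) → (Fin p → Bool)) : Prop where
  incl : IsBoxMap ι
  retr : IsBoxMap r
  retr_incl : ∀ x, r (ι x) = x
  incl_retr : ∀ x, (ι fun _ => false) ≤ x → (x ≤ ι fun _ => true) → ι (r x) = x

lemma IsInterval.nil :
    IsInterval (fun x : Fin 0 → Bool => x) (fun x : Fin 0 → Bool => x) where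
  incl := .id 0
  retr := .id 0
  retr_incl _ := rfl
  incl_retr _ _ _ := rfl

lemma IsInterval.cons {p n : ℕ} {ι : (Fin p → Bool) → (Fin n → Bool)}
    {r : (Fin n → Bool) → (Fin p → Bool)} (h : IsInterval ι r) (ε : Bool) :
    IsInterval (fun x => (Fin.cons ε (ι x) : Fin (n + 1) → Bool)) (fun x => r (Fin.tail x)) where
  incl := h.incl.comp (isBoxMap_cons ε)
  retr := isBoxMap_tail.comp h.retr
  retr_incl x := by simp [h.retr_incl]
  incl_retr x h0 h1 := by
    have h2 : x 0 = ε := le_antisymm (h1 0) (h0 0)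
    have h3 := h.incl_retr (Fin.tail x) (fun j => h0 j.succ) (fun j => h1 j.succ)
    simp only [h3, ← h2]
    exact Fin.cons_self_tail x

lemma IsInterval.lift {p n : ℕ} {ι : (Fin p → Bool) → (Fin n → Bool)}
    {r : (Fin n → Bool) → (Fin p → Bool)} (h : IsInterval ι r) :
    IsInterval (lift ι) (lift r) where
  incl := h.incl.lift
  retr := h.retr.lift
  retr_incl x := by
    simp only [lift_comp, h.retr_incl, lift_id]
  incl_retr x h0 h1 := by
    have h3 := h.incl_retr (Fin.tail x) (fun j => h0 j.succ) (fun j => h1 j.succ)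
    refine Eq.trans ?_ (Fin.cons_self_tail x)
    exact congrArg (fun y => (Fin.cons (x 0) y : Fin (n + 1) → Bool)) h3

/-- Coordinates where `u` and `v` agree are frozen, the others are left free; where they differ, `u
≤ v` forces the values false and true. -/
lemma exists_isInterval {n : ℕ} {u v : Fin n → Bool} (h : u ≤ v) :
    ∃ (p : ℕ) (ι : (Fin p → Bool) → (Fin n → Bool)) (r : (Fin n → Bool) → (Fin p → Bool)),
      IsInterval ι r ∧ (ι fun _ => false) = u ∧ (ι fun _ => true) = v := by
  induction n with
  | zero => exact ⟨0, _, _, .nil, Subsingleton.elim _ _, Subsingleton.elim _ _⟩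
  | succ n ih =>
    obtain ⟨p, ι, r, hι, h0, h1⟩ := @ih (Fin.tail u) (Fin.tail v) (fun j => h j.succ)
    by_cases huv : u 0 = v 0
    · refine ⟨p, _, _, hι.cons (u 0), ?_, ?_⟩
      · rw [h0]; exact Fin.cons_self_tail u
      · rw [h1, huv]; exact Fin.cons_self_tail v
    · have h2 := h 0
      refine ⟨p + 1, _, _, hι.lift, ?_, ?_⟩
      · refine Eq.trans ?_ (Fin.cons_self_tail u)
        have : u 0 = false := by revert huv h2; cases u 0 <;> cases v 0 <;> simp
        rw [this, ← h0]; rfl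
      · refine Eq.trans ?_ (Fin.cons_self_tail v)
        have : v 0 = true := by revert huv h2; cases u 0 <;> cases v 0 <;> simp
        rw [this, ← h1]; rfl

/-- `e` is a split epimorphism of the cube category, preserving the extremal vertices. -/
structure IsSplit {p n : ℕ} (e : (Fin n → Bool) → (Fin p → Bool))
    (σ : (Fin p → Bool) → (Fin n → Bool)) : Prop where
  isBoxMap : IsBoxMap e
  sec : IsBoxMap σ
  comp_sec : ∀ x, e (σ x) = x
  bot : (e fun _ => false) = fun _ => false
  top : (e fun _ => true) = fun _ => true

lemma IsSplit.lift {p n : ℕ} {e : (Fin n → Bool) → (Fin p → Bool)}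
    {σ : (Fin p → Bool) → (Fin n → Bool)} (h : IsSplit e σ) : IsSplit (lift e) (lift σ) where
  isBoxMap := h.isBoxMap.lift
  sec := h.sec.lift
  comp_sec x := by simp only [lift_comp, h.comp_sec, lift_id]
  bot := by
    funext j
    refine Fin.cases rfl (fun j => ?_) j
    exact congrFun h.bot j
  top := by
    funext j
    refine Fin.cases rfl (fun j => ?_) j
    exact congrFun h.top j

lemma IsSplit.comp {p m n : ℕ} {e : (Fin n → Bool) → (Fin m → Bool)}
    {σ : (Fin m → Bool) → (Fin n → Bool)} {e' : (Fin m → Bool) → (Fin p → Bool)}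
    {σ' : (Fin p → Bool) → (Fin m → Bool)} (h : IsSplit e σ) (h' : IsSplit e' σ') :
    IsSplit (fun x => e' (e x)) (fun x => σ (σ' x)) where
  isBoxMap := h.isBoxMap.comp h'.isBoxMap
  sec := h'.sec.comp h.sec
  comp_sec x := by simp only [h.comp_sec, h'.comp_sec]
  bot := by rw [h.bot, h'.bot]
  top := by rw [h.top, h'.top]

/-- Inserting false as first coordinate is a section of the degeneracy and also of the connection,
since false is neutral for the maximum. -/
lemma IsEpiGen.exists_isSplit {m n : ℕ} {e : (Fin n → Bool) → (Fin m → Bool)}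
    (he : IsEpiGen e) : ∃ σ, IsSplit e σ := by
  induction he with
  | tail n =>
    exact ⟨fun x => Fin.cons false x, isBoxMap_tail, isBoxMap_cons false, fun x => rfl, rfl, rfl⟩
  | conn n =>
    refine ⟨fun x => Fin.cons false x, .conn _, isBoxMap_cons false, conn_cons_false, ?_, ?_⟩
    · funext j; simp [Box.conn]
    · funext j; simp [Box.conn]
  | lift hf ih => exact ⟨_, ih.choose_spec.lift⟩

/-- Every map of cubes factors as a split epimorphism preserving the extremal vertices followed by
the inclusion of an interval. -/
lemma IsBoxMap.exists_factorization {m n : ℕ} {f : (Fin m → Bool) → (Fin n → Bool)}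
    (hf : IsBoxMap f) :
    ∃ (p : ℕ) (e : (Fin m → Bool) → (Fin p → Bool)) (σ : (Fin p → Bool) → (Fin m → Bool))
      (ι : (Fin p → Bool) → (Fin n → Bool)) (r : (Fin n → Bool) → (Fin p → Bool)),
      IsSplit e σ ∧ IsInterval ι r ∧ ∀ x, f x = ι (e x) := by
  have hf' := hf.isNormal
  clear hf
  induction hf' with
  | nil => exact ⟨0, _, _, _, _, ⟨.id 0, .id 0, fun _ => rfl, rfl, rfl⟩, .nil, fun _ => rfl⟩
  | cons ε _ ih =>
    obtain ⟨p, e, σ, ι, r, he, hι, h⟩ := ih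
    exact ⟨p, e, σ, _, _, he, hι.cons ε, fun x => by simp only [h]⟩
  | lift _ ih =>
    obtain ⟨p, e, σ, ι, r, he, hι, h⟩ := ih
    refine ⟨p + 1, _, _, _, _, he.lift, hι.lift, fun x => ?_⟩
    rw [lift_comp]
    exact congrArg (fun f => Box.lift f x) (funext h)
  | pre hg _ ih =>
    obtain ⟨p, e, σ, ι, r, he, hι, h⟩ := ih
    obtain ⟨σ', hσ'⟩ := hg.exists_isSplit
    exact ⟨p, _, _, ι, r, hσ'.comp he, hι, fun x => h _⟩

lemma isBoxMap_toPoint (m : ℕ) (e : Fin 0 → Bool) : IsBoxMap (fun _ : Fin m → Bool => e) := by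
  induction m with
  | zero =>
    have : (fun _ : Fin 0 → Bool => e) = fun x => x := by
      funext x j; exact j.elim0
    rw [this]; exact .id 0
  | succ m ih => exact isBoxMap_tail.comp ih

/-- The map to the terminal object of the cube category. -/
def toPoint (c : Box) : c ⟶ ⟨0⟩ := ⟨fun _ _ => false, isBoxMap_toPoint _ _⟩

end Box

/-! ### Bounds for maps from necklaces to cubes -/

namespace Bip

open Box

/-- The coordinates of a vertex of a cube. -/
def coord {m : ℕ} (a : cube 0 ⟶ cube m) : Fin m → Bool := (yonedaEquiv a).toFun fun _ => false

lemma coord_vertex {m : ℕ} (v : Fin m → Bool) : coord (yoneda.map (vertex v)) = v := by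
  rw [coord, yonedaEquiv_yoneda_map]; rfl

lemma coord_comp {m n : ℕ} (a : cube 0 ⟶ cube m) (f : (⟨m⟩ : Box) ⟶ ⟨n⟩) :
    coord (a ≫ yoneda.map f) = f.toFun (coord a) := by
  rw [coord, yonedaEquiv_comp]; rfl

lemma eq_vertex {m : ℕ} (a : cube 0 ⟶ cube m) : a = yoneda.map (vertex (coord a)) := by
  apply yonedaEquiv.injective
  rw [yonedaEquiv_yoneda_map]
  apply Box.hom_ext
  intro x
  have : x = fun _ => false := Subsingleton.elim _ _
  rw [this]; rfl

/-- All maps of a double pointed cubical set to cubes take values between the images of the two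
distinguished points. -/
def Bounded (P : Bip) : Prop :=
  ∀ (m : ℕ) (F : P.X ⟶ cube m) (c : Box) (x : P.X.obj (op c)) (z : Fin c.dim → Bool),
    coord (P.src ≫ F) ≤ (F.app (op c) x).toFun z ∧ (F.app (op c) x).toFun z ≤ coord (P.tgt ≫ F)

lemma Bounded.le {P : Bip} (hP : P.Bounded) {m : ℕ} (F : P.X ⟶ cube m) :
    coord (P.src ≫ F) ≤ coord (P.tgt ≫ F) :=
  (hP m F ⟨0⟩ (P.tgt.app _ (𝟙 _)) (fun _ => false)).1

/-- Maps of cubes are monotone, and the distinguished points are the extremal vertices. -/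
lemma bounded_box (n : ℕ) : (box n).Bounded := by
  intro m F c x z
  obtain ⟨f, rfl⟩ := yoneda.map_surjective F
  have h1 : coord ((box n).src ≫ yoneda.map f) = f.toFun fun _ => false := by
    exact (coord_comp _ _).trans (congrArg f.toFun (coord_vertex _))
  have h2 : coord ((box n).tgt ≫ yoneda.map f) = f.toFun fun _ => true := by
    exact (coord_comp _ _).trans (congrArg f.toFun (coord_vertex _))
  rw [h1, h2]
  exact ⟨f.isBoxMap.monotone fun j => Bool.false_le _, f.isBoxMap.monotone fun j => Bool.le_true _⟩

/-- Simplices of a wedge come from one of the two summands. -/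
lemma wedge_cases {P Q : Bip} {c : Boxᵒᵖ} (x : (wedge P Q).X.obj c) :
    (∃ y, (inl P Q).app c y = x) ∨ ∃ y, (inr P Q).app c y = x := by
  obtain ⟨j, y, hy⟩ := FunctorToTypes.jointly_surjective _ c (pushoutIsPushout P.tgt Q.src) x
  rcases j with _ | _ | _
  · left
    refine ⟨P.tgt.app c y, ?_⟩
    rw [hy]
    exact (ConcreteCategory.congr_hom (NatTrans.congr_app
      ((PushoutCocone.mk _ _ (pushout.condition (f := P.tgt) (g := Q.src))).condition_zero) c)
        y).symm
  · exact Or.inl ⟨y, hy.symm⟩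
  · exact Or.inr ⟨y, hy.symm⟩

/-- By `Bounded.le` for each summand, the image of the gluing vertex lies between those of the two
ends, so the bounds of the summands combine by transitivity. -/
lemma Bounded.wedge {P Q : Bip} (hP : P.Bounded) (hQ : Q.Bounded) : (wedge P Q).Bounded := by
  intro m F c x z
  have e1 := hP.le (inl P Q ≫ F)
  have e2 := hQ.le (inr P Q ≫ F)
  rw [condition_assoc] at e1
  rcases wedge_cases x with ⟨y, rfl⟩ | ⟨y, rfl⟩
  · have h := hP m (inl P Q ≫ F) c y z
    rw [condition_assoc] at h
    exact ⟨h.1, h.2.trans e2⟩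
  · have h := hQ m (inr P Q ≫ F) c y z
    exact ⟨e1.trans h.1, h.2⟩

lemma Bounded.of_iso {P Q : Bip} (hP : P.Bounded) (e : P ≅ Q) : Q.Bounded := by
  intro m F c x z
  have h := hP m (e.hom.hom ≫ F) c (e.inv.hom.app _ x) z
  rw [src_hom_assoc, tgt_hom_assoc] at h
  have e1 : e.inv.hom ≫ e.hom.hom = 𝟙 _ := congrArg Hom.hom e.inv_hom_id
  have e2 : e.hom.hom.app _ (e.inv.hom.app _ x) = x :=
    ConcreteCategory.congr_hom (NatTrans.congr_app e1 (op c)) x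
  rw [NatTrans.comp_app, ConcreteCategory.comp_apply, e2] at h
  exact h

/-! ### Necklaces up to isomorphism and their concatenation -/

/-- The left unit constraint of the wedge sum, as an isomorphism. -/
def leftUnitIso (P : Bip) : P ≅ wedge unit P where
  hom := leftUnit P
  inv := conc (S := P.X) (const P.src) (𝟙 P)
  hom_inv_id := hom_ext (inr_conc (S := P.X) (const P.src) (𝟙 P))
  inv_hom_id := by
    apply wedge_hom_ext
    · rw [comp_hom, inl_conc_assoc]
      exact (condition unit P).symm.trans ((Category.id_comp _).trans (Category.comp_id _).symm)
    · rw [comp_hom, inr_conc_assoc]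
      exact (Category.id_comp _).trans (Category.comp_id _).symm

/-- The `0`-cube is the unit of the wedge sum. -/
def boxZeroIso : box 0 ≅ unit where
  hom := ⟨𝟙 _, (Category.comp_id _).trans ((congrArg yoneda.map
      (Box.hom_ext fun _ => Subsingleton.elim _ _)).trans (yoneda.map_id _)),
    (Category.comp_id _).trans ((congrArg yoneda.map
      (Box.hom_ext fun _ => Subsingleton.elim _ _)).trans (yoneda.map_id _))⟩
  inv := ⟨𝟙 _, ((congrArg yoneda.map
      (Box.hom_ext fun _ => Subsingleton.elim _ _)).trans (yoneda.map_id _)).symm,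
    ((congrArg yoneda.map
      (Box.hom_ext fun _ => Subsingleton.elim _ _)).trans (yoneda.map_id _)).symm⟩
  hom_inv_id := hom_ext (Category.comp_id _)
  inv_hom_id := hom_ext (Category.comp_id _)

/-- Concatenation of necklaces. -/
def neckAppend : ∀ l l' : List ℕ+, wedge (neck l) (neck l') ≅ neck (l ++ l')
  | [], _ => (leftUnitIso _).symm
  | n :: l, l' => wedgeAssoc (box n) (neck l) (neck l') ≪≫ wedgeIso (Iso.refl _) (neckAppend l l')

/-- The double pointed cubical sets isomorphic to necklaces. -/
def IsNeck (P : Bip) : Prop := ∃ l, Nonempty (P ≅ neck l)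

lemma isNeck_neck (l : List ℕ+) : IsNeck (neck l) := ⟨l, ⟨Iso.refl _⟩⟩

lemma IsNeck.of_iso {P Q : Bip} (hP : IsNeck P) (e : P ≅ Q) : IsNeck Q :=
  ⟨hP.choose, ⟨e.symm ≪≫ hP.choose_spec.some⟩⟩

lemma isNeck_unit : IsNeck unit := isNeck_neck []

lemma isNeck_box (n : ℕ) : IsNeck (box n) := by
  obtain rfl | hn := Nat.eq_zero_or_pos n
  · exact isNeck_unit.of_iso boxZeroIso.symm
  · exact (isNeck_neck [⟨n, hn⟩]).of_iso (rightUnit (box n)).symm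

lemma IsNeck.wedge {P Q : Bip} (hP : IsNeck P) (hQ : IsNeck Q) : IsNeck (wedge P Q) := by
  obtain ⟨l, ⟨e⟩⟩ := hP
  obtain ⟨l', ⟨e'⟩⟩ := hQ
  exact ⟨l ++ l', ⟨wedgeIso e e' ≪≫ neckAppend l l'⟩⟩

lemma bounded_unit : unit.Bounded := (bounded_box 0).of_iso boxZeroIso

lemma IsNeck.bounded {P : Bip} (hP : IsNeck P) : P.Bounded := by
  obtain ⟨l, ⟨e⟩⟩ := hP
  refine Bounded.of_iso ?_ e.symm
  clear e
  induction l with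
  | nil => exact bounded_unit
  | cons n l ih => exact (bounded_box n).wedge ih

lemma bounded_I (n : ℕ) : (Path.I n).Bounded := by
  induction n with
  | zero => exact bounded_unit
  | succ n ih => exact ih.wedge (bounded_box 1)

/-- Controlling the two distinguished points suffices: by boundedness all values of `F` then lie in
the interval, where the retraction acts as the identity. -/
lemma Bounded.retract {P : Bip} (hP : P.Bounded) {m p : ℕ} (F : P.X ⟶ cube m)
    {ι : (⟨p⟩ : Box) ⟶ ⟨m⟩} {r : (⟨m⟩ : Box) ⟶ ⟨p⟩} (h : IsInterval ι.toFun r.toFun)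
    (h0 : ι.toFun (fun _ => false) ≤ coord (P.src ≫ F))
    (h1 : coord (P.tgt ≫ F) ≤ ι.toFun fun _ => true) :
    F ≫ yoneda.map r ≫ yoneda.map ι = F := by
  ext c x
  apply Box.hom_ext
  intro z
  have hb := hP m F c.unop x z
  exact h.incl_retr _ (h0.trans hb.1) (hb.2.trans h1)

/-! ### Images of necklaces in cubical subsets of cubes -/

variable {P Q : Bip} {S : CubicalSet} {a b c : cube 0 ⟶ S}

/-- A concatenation of monomorphisms in a cubical subset of a cube is a monomorphism. -/
lemma mono_conc {n : ℕ} (i : S ⟶ cube n) [Mono i] (hP : P.Bounded) (hQ : Q.Bounded)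
    (f : P ⟶ ⟨S, a, b⟩) (g : Q ⟶ ⟨S, b, c⟩) [Mono f.hom] [Mono g.hom] :
    Mono (conc f g).hom := by
  have hinj : ∀ {A B : CubicalSet} (h : A ⟶ B) [Mono h] (k : Boxᵒᵖ),
      Function.Injective (h.app k) := fun h _ k =>
    (mono_iff_injective _).1 ((NatTrans.mono_iff_mono_app h).1 inferInstance k)
  -- In the ambient cube the values of `f` lie below the image of `b` and those of `g` above it. A
  -- common value is therefore constant at `b`, and injectivity of `f` and `g` places both preimages
  -- at the gluing vertex.
  have key : ∀ (k : Boxᵒᵖ) (x : P.X.obj k) (y : Q.X.obj k), f.hom.app k x = g.hom.app k y →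
      (inl P Q).app k x = (inr P Q).app k y := by
    intro k x y hxy
    have hb : f.hom.app k x = b.app k (toPoint k.unop) := by
      apply hinj i k
      apply Box.hom_ext
      intro z
      have h1 := (hP n (f.hom ≫ i) k.unop x z).2
      have h2 := (hQ n (g.hom ≫ i) k.unop y z).1
      rw [tgt_hom_assoc] at h1
      rw [src_hom_assoc] at h2
      have h3 : i.app k (f.hom.app k x) = i.app k (g.hom.app k y) := by rw [hxy]
      have h4 : (i.app k (f.hom.app k x)).toFun z = coord (b ≫ i) :=
        le_antisymm h1 (by rw [h3]; exact h2)
      rw [h4]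
      have h5 : (b ≫ i).app k (toPoint k.unop) = (yoneda.map (vertex (coord (b ≫ i)))).app k
          (toPoint k.unop) :=
        congrArg (fun t : cube 0 ⟶ cube n => t.app k (toPoint k.unop)) (eq_vertex (b ≫ i))
      exact (congrArg (fun t : k.unop ⟶ ⟨n⟩ => t.toFun z) h5).symm
    have hx : x = P.tgt.app k (toPoint k.unop) := by
      apply hinj f.hom k
      rw [hb, ← ConcreteCategory.comp_apply, ← NatTrans.comp_app, tgt_hom]
    have hy : y = Q.src.app k (toPoint k.unop) := by
      apply hinj g.hom k
      rw [← hxy, hb, ← ConcreteCategory.comp_apply, ← NatTrans.comp_app, src_hom]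
    rw [hx, hy]
    exact ConcreteCategory.congr_hom (NatTrans.congr_app (condition P Q) k) _
  rw [NatTrans.mono_iff_mono_app]
  intro k
  rw [mono_iff_injective]
  have hl : ∀ x, (conc f g).hom.app k ((inl P Q).app k x) = f.hom.app k x := fun x =>
    ConcreteCategory.congr_hom (NatTrans.congr_app (inl_conc f g) k) x
  have hr : ∀ x, (conc f g).hom.app k ((inr P Q).app k x) = g.hom.app k x := fun x =>
    ConcreteCategory.congr_hom (NatTrans.congr_app (inr_conc f g) k) x
  intro x y hxy
  rcases wedge_cases x with ⟨x, rfl⟩ | ⟨x, rfl⟩ <;> rcases wedge_cases y with ⟨y, rfl⟩ | ⟨y, rfl⟩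
  · rw [hl, hl] at hxy
    rw [hinj f.hom k hxy]
  · rw [hl, hr] at hxy
    exact key k x y hxy
  · rw [hl, hr] at hxy
    exact (key k y x hxy.symm).symm
  · rw [hr, hr] at hxy
    rw [hinj g.hom k hxy]

lemma epi_wmap {P' Q' : Bip} (f : P ⟶ P') (g : Q ⟶ Q') [Epi f.hom] [Epi g.hom] :
    Epi (wmap f g).hom where
  left_cancellation u v h := by
    apply wedge_ext
    · rw [← cancel_epi f.hom, ← inl_wmap_assoc f g, ← inl_wmap_assoc f g, h]
    · rw [← cancel_epi g.hom, ← inr_wmap_assoc f g, ← inr_wmap_assoc f g, h]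

/-- Maps from a cube to a cubical subset of a cube have images that are cubes. -/
lemma exists_image_cube {n m : ℕ} (i : S ⟶ cube n) [Mono i] (f : cube m ⟶ S) :
    ∃ (p : ℕ) (e : (⟨m⟩ : Box) ⟶ ⟨p⟩) (g : cube p ⟶ S), IsSplitEpi e ∧
      (e.toFun fun _ => false) = (fun _ => false) ∧ (e.toFun fun _ => true) = (fun _ => true) ∧
      Mono g ∧ yoneda.map e ≫ g = f := by
  obtain ⟨φ, hφ⟩ := yoneda.map_surjective (f ≫ i)
  obtain ⟨p, e, σ, ι, r, he, hι, h⟩ := φ.isBoxMap.exists_factorization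
  let e' : (⟨m⟩ : Box) ⟶ ⟨p⟩ := ⟨e, he.isBoxMap⟩
  let σ' : (⟨p⟩ : Box) ⟶ ⟨m⟩ := ⟨σ, he.sec⟩
  let ι' : (⟨p⟩ : Box) ⟶ ⟨n⟩ := ⟨ι, hι.incl⟩
  let r' : (⟨n⟩ : Box) ⟶ ⟨p⟩ := ⟨r, hι.retr⟩
  have hσe : σ' ≫ e' = 𝟙 _ := Box.hom_ext he.comp_sec
  have hιr : ι' ≫ r' = 𝟙 _ := Box.hom_ext hι.retr_incl
  have hφ' : φ = e' ≫ ι' := Box.hom_ext h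
  -- The interval inclusion must be lifted from `cube n` to `S`: restricting `f` along the section
  -- `σ'` does this, since followed by `i` it becomes `ι'`.
  refine ⟨p, e', yoneda.map σ' ≫ f, ⟨⟨σ', hσe⟩⟩, he.bot, he.top, ?_, ?_⟩
  · have h1 : (yoneda.map σ' ≫ f) ≫ i = yoneda.map ι' := by
      rw [Category.assoc, ← hφ, ← yoneda.map_comp, hφ', reassoc_of% hσe]
    have h2 : Mono ι' := (SplitMono.mk r' hιr).mono
    have h3 : Mono ((yoneda.map σ' ≫ f) ≫ i) := by rw [h1]; infer_instance
    exact mono_of_mono _ i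
  · rw [← cancel_mono i, Category.assoc, Category.assoc, ← hφ, ← yoneda.map_comp,
      ← yoneda.map_comp, hφ', reassoc_of% hσe]

/-- The factorisation is compatible with the distinguished points because its epimorphism preserves
the extremal vertices. -/
lemma exists_image_box {n m : ℕ} (i : S ⟶ cube n) [Mono i] (f : box m ⟶ ⟨S, a, b⟩) :
    ∃ (p : ℕ) (e : box m ⟶ box p) (g : box p ⟶ ⟨S, a, b⟩),
      Epi e.hom ∧ Mono g.hom ∧ e ≫ g = f := by
  obtain ⟨p, e, g, he, h0, h1, hg, hf⟩ := exists_image_cube i f.hom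
  let E : box m ⟶ box p := ⟨yoneda.map e,
      (yoneda.map_comp _ _).symm.trans (congrArg yoneda.map (Box.hom_ext fun _ => h0)),
      (yoneda.map_comp _ _).symm.trans (congrArg yoneda.map (Box.hom_ext fun _ => h1))⟩
  refine ⟨p, E, ⟨g, ?_, ?_⟩, inferInstanceAs (Epi (yoneda.map e)), hg, hom_ext hf⟩
  · rw [← E.src]
    exact (Category.assoc _ _ _).trans ((congrArg (fun t => (box m).src ≫ t) hf).trans f.src)
  · rw [← E.tgt]
    exact (Category.assoc _ _ _).trans ((congrArg (fun t => (box m).tgt ≫ t) hf).trans f.tgt)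

/-- Maps from a necklace to a cubical subset of a cube have images that are necklaces. -/
lemma exists_image_neck {n : ℕ} (i : S ⟶ cube n) [Mono i] (l : List ℕ+) {a b : cube 0 ⟶ S}
    (f : neck l ⟶ ⟨S, a, b⟩) :
    ∃ (P : Bip) (e : neck l ⟶ P) (g : P ⟶ ⟨S, a, b⟩),
      IsNeck P ∧ Epi e.hom ∧ Mono g.hom ∧ e ≫ g = f := by
  induction l generalizing a b with
  | nil =>
    refine ⟨unit, 𝟙 _, f, isNeck_unit, inferInstanceAs (Epi (𝟙 _)), ?_, Category.id_comp _⟩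
    -- Any map out of the terminal cubical set is a monomorphism.
    refine ⟨fun u v _ => ?_⟩
    ext c x
    exact Box.hom_ext fun _ => Subsingleton.elim _ _
  | cons m l ih =>
    obtain ⟨c, f, f', rfl⟩ := exists_conc f
    obtain ⟨p, e, g, he, hg, rfl⟩ := exists_image_box i f
    obtain ⟨P, e', g', hP, he', hg', rfl⟩ := ih f'
    -- Here `p` may be zero: a bead collapsed to a point disappears, which is why the image is a
    -- necklace only up to isomorphism.
    exact ⟨wedge (box p) P, wmap e e', conc g g', (isNeck_box p).wedge hP, epi_wmap e e',
      mono_conc i (bounded_box p) hP.bounded g g', wmap_conc _ _ _ _⟩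

end Bip

/-! ### Finality of the monomorphic necklaces -/

open Bip in
/-- For a cubical subset of a cube, the inclusion of monomorphic necklaces is final. -/
lemma final_subNeckIncl {n : ℕ} {S : CubicalSet} (i : S ⟶ cube n) [Mono i] (a b : cube 0 ⟶ S) :
    (subNeckIncl ⟨S, a, b⟩).Final := by
  refine ⟨fun d => ?_⟩
  obtain ⟨P, e, g, ⟨l, ⟨φ⟩⟩, he, hg, hfac⟩ := exists_image_neck i d.left (a := a) (b := b) d.hom
  have hm : Mono (φ.inv ≫ g).hom := by
    have : Mono φ.inv.hom := by
      have h : φ.inv.hom ≫ φ.hom.hom = 𝟙 _ := congrArg Hom.hom φ.inv_hom_id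
      exact (SplitMono.mk _ h).mono
    exact mono_comp _ _
  let T : SubNeck ⟨S, a, b⟩ :=
    ⟨CostructuredArrow.mk (S := necIncl) (Y := (show Nec from l)) (φ.inv ≫ g), hm⟩
  let h : d ⟶ (subNeckIncl ⟨S, a, b⟩).obj T :=
    CostructuredArrow.homMk (necIncl.preimage (Y := (show Nec from l)) (e ≫ φ.hom)) (by
      rw [necIncl.map_preimage]
      show (e ≫ φ.hom) ≫ φ.inv ≫ g = d.hom
      rw [Category.assoc, Iso.hom_inv_id_assoc, hfac])
  have hh : Epi (necIncl.map h.left).hom := by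
    show Epi (necIncl.map (necIncl.preimage (Y := (show Nec from l)) (e ≫ φ.hom))).hom
    rw [necIncl.map_preimage]
    have : Epi φ.hom.hom := by
      have h : φ.inv.hom ≫ φ.hom.hom = 𝟙 _ := congrArg Hom.hom φ.inv_hom_id
      exact (SplitEpi.mk _ h).epi
    exact epi_comp _ _
  -- The map onto the image is weakly initial: in any other factorisation through a monomorphic
  -- necklace, the epimorphism `h` lifts against the monomorphism. Connectedness needs no
  -- uniqueness.
  have key : ∀ X : StructuredArrow d (subNeckIncl ⟨S, a, b⟩),
      Nonempty (StructuredArrow.mk h ⟶ X) := by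
    intro X
    have hX : Mono X.right.obj.hom.hom := X.right.property
    have w : (necIncl.map h.left).hom ≫ T.obj.hom.hom =
        (necIncl.map X.hom.left).hom ≫ X.right.obj.hom.hom :=
      congrArg Hom.hom ((CostructuredArrow.w h).trans (CostructuredArrow.w X.hom).symm)
    have sq : CommSq (necIncl.map X.hom.left).hom (necIncl.map h.left).hom
      X.right.obj.hom.hom T.obj.hom.hom := ⟨w.symm⟩
    have : StrongEpi (necIncl.map h.left).hom := strongEpi_of_epi _
    -- The lift respects the distinguished points because this can be checked after the monomorphism
    -- to `S`.
    let L : necIncl.obj T.obj.left ⟶ necIncl.obj X.right.obj.left := ⟨sq.lift, by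
        rw [← cancel_mono X.right.obj.hom.hom, Category.assoc, sq.fac_right]
        exact T.obj.hom.src.trans X.right.obj.hom.src.symm, by
        rw [← cancel_mono X.right.obj.hom.hom, Category.assoc, sq.fac_right]
        exact T.obj.hom.tgt.trans X.right.obj.hom.tgt.symm⟩
    refine ⟨StructuredArrow.homMk (ObjectProperty.homMk
      (CostructuredArrow.homMk (necIncl.preimage L) ?_)) ?_⟩
    · rw [necIncl.map_preimage]
      exact hom_ext sq.fac_right
    · apply CostructuredArrow.hom_ext
      apply necIncl.map_injective
      refine (necIncl.map_comp _ _).trans ?_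
      refine (congrArg (fun t => necIncl.map h.left ≫ t) (necIncl.map_preimage L)).trans ?_
      exact hom_ext sq.fac_left
  have : Nonempty (StructuredArrow d (subNeckIncl ⟨S, a, b⟩)) := ⟨.mk h⟩
  exact zigzag_isConnected fun X Y =>
    (Zigzag.of_inv (key X).some).trans (Zigzag.of_hom (key Y).some)

open Bip

/-! ### Simplices of mapping spaces of the rigidification -/

/-- The `k`-simplices of the mapping space between the distinguished points. -/
abbrev RigidSimplex (P : Bip) (k : SimplexCategoryᵒᵖ) : Type := (rigidHom.obj P).obj k

namespace Bip

/-- The inclusion of the first summand of a wedge, as a double pointed map. -/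
def inlHom (P Q : Bip) : P ⟶ ⟨(wedge P Q).X, (wedge P Q).src, P.tgt ≫ inl P Q⟩ :=
  ⟨inl P Q, rfl, rfl⟩

/-- The inclusion of the second summand of a wedge, as a double pointed map. -/
def inrHom (P Q : Bip) : Q ⟶ ⟨(wedge P Q).X, P.tgt ≫ inl P Q, (wedge P Q).tgt⟩ :=
  ⟨inr P Q, (condition P Q).symm, rfl⟩

end Bip

namespace RigidSimplex

variable {P Q R P' Q' : Bip} {k l : SimplexCategoryᵒᵖ} {S T : CubicalSet}
  {a b c d : cube 0 ⟶ S} {u v w : cube 0 ⟶ T}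

/-- The map induced by a map of double pointed cubical sets. -/
def map (f : P ⟶ Q) (s : RigidSimplex P k) : RigidSimplex Q k := (rigidHom.map f).app k s

lemma map_id (s : RigidSimplex P k) : map (𝟙 P) s = s := by
  unfold map; rw [rigidHom.map_id]; rfl

lemma map_comp (f : P ⟶ Q) (g : Q ⟶ R) (s : RigidSimplex P k) :
    map (f ≫ g) s = map g (map f s) := by
  unfold map; rw [rigidHom.map_comp]; rfl

lemma map_op (f : P ⟶ Q) (θ : k ⟶ l) (s : RigidSimplex P k) :
    (rigidHom.obj Q).map θ (map f s) = map f ((rigidHom.obj P).map θ s) :=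
  (ConcreteCategory.congr_hom ((rigidHom.map f).naturality θ) s).symm

lemma eqToHom_app_heq {X Y : SSet.{0}} (h : X = Y) (s : X.obj k) :
    HEq ((eqToHom h).app k s) s := by
  subst h; rfl

/-- The functor `rigidHom` contains an `eqToHom`, since vertices are preserved only up to a
propositional equality; heterogeneous equality removes it. -/
lemma map_heq (f : P ⟶ Q) (s : RigidSimplex P k) :
    HEq (map f s) (SCat.sMap (rigidification.map f.hom) (x := rigidVertex P.src)
      (y := rigidVertex P.tgt) s) :=
  eqToHom_app_heq _ _

/-- Composition of simplices of mapping spaces. -/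
def comp (s : RigidSimplex ⟨S, a, b⟩ k) (t : RigidSimplex ⟨S, b, c⟩ k) :
    RigidSimplex ⟨S, a, c⟩ k :=
  (rigidification.obj S).sComp (x := rigidVertex a) (y := rigidVertex b) (z := rigidVertex c) s t

/-- The identity. -/
def one (k : SimplexCategoryᵒᵖ) (a : cube 0 ⟶ S) : RigidSimplex ⟨S, a, a⟩ k :=
  (rigidification.obj S).sId k (rigidVertex a)

lemma one_comp (s : RigidSimplex ⟨S, a, b⟩ k) : comp (one k a) s = s := SCat.sId_comp _

lemma comp_one (s : RigidSimplex ⟨S, a, b⟩ k) : comp s (one k b) = s := SCat.sComp_id _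

lemma assoc (s : RigidSimplex ⟨S, a, b⟩ k) (t : RigidSimplex ⟨S, b, c⟩ k)
    (r : RigidSimplex ⟨S, c, d⟩ k) : comp (comp s t) r = comp s (comp t r) :=
  SCat.s_assoc _ _ _

lemma op_comp (θ : k ⟶ l) (s : RigidSimplex ⟨S, a, b⟩ k) (t : RigidSimplex ⟨S, b, c⟩ k) :
    (rigidHom.obj ⟨S, a, c⟩).map θ (comp s t) =
      comp ((rigidHom.obj ⟨S, a, b⟩).map θ s) ((rigidHom.obj ⟨S, b, c⟩).map θ t) :=
  SCat.map_sComp _ _ _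

lemma op_one (θ : k ⟶ l) (a : cube 0 ⟶ S) :
    (rigidHom.obj ⟨S, a, a⟩).map θ (one k a) = one l a :=
  SCat.map_sId _ _

lemma map_mapOf_comp (h : S ⟶ T) (ha : a ≫ h = u) (hb : b ≫ h = v) (hc : c ≫ h = w)
    (s : RigidSimplex ⟨S, a, b⟩ k) (t : RigidSimplex ⟨S, b, c⟩ k) :
    map (mapOf h ha hc) (comp s t) = comp (map (mapOf h ha hb) s) (map (mapOf h hb hc) t) := by
  subst ha hb hc
  apply eq_of_heq
  refine (map_heq _ _).trans ?_
  refine (heq_of_eq (SCat.sMap_sComp (rigidification.map h) _ _)).trans ?_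
  exact SCat.sComp_heq (rigidVertex_comp _ _) (rigidVertex_comp _ _) (rigidVertex_comp _ _)
    (map_heq (mapOf h rfl rfl) s).symm (map_heq (mapOf h rfl rfl) t).symm

lemma map_mapOf_one (h : S ⟶ T) (ha : a ≫ h = u) :
    map (mapOf h ha ha) (one k a) = one k u := by
  subst ha
  apply eq_of_heq
  refine (map_heq _ _).trans ?_
  refine (heq_of_eq (SCat.sMap_sId (rigidification.map h) (rigidVertex a))).trans ?_
  rw [rigidVertex_comp]
  rfl

/-- The concatenation of simplices, in the mapping space of a wedge. -/
def conc (s : RigidSimplex P k) (t : RigidSimplex Q k) : RigidSimplex (wedge P Q) k :=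
  comp (S := (wedge P Q).X) (map (inlHom P Q) s) (map (inrHom P Q) t)

/-- This transfers identities between composites in the rigidification to concatenations of
simplices on wedges, once the maps of wedges are written as `Bip.conc`. -/
lemma map_conc (f : P ⟶ ⟨S, a, b⟩) (g : Q ⟶ ⟨S, b, c⟩) (s : RigidSimplex P k)
    (t : RigidSimplex Q k) : map (Bip.conc f g) (conc s t) = comp (map f s) (map g t) := by
  have hb : (P.tgt ≫ inl P Q) ≫ (Bip.conc f g).hom = b := by
    rw [Category.assoc, inl_conc]; exact f.tgt
  refine (map_mapOf_comp (Bip.conc f g).hom (Bip.conc f g).src hb (Bip.conc f g).tgt _ _).trans ?_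
  have h1 : inlHom P Q ≫ mapOf (Bip.conc f g).hom (Bip.conc f g).src hb = f :=
    hom_ext (inl_conc f g)
  have h2 : inrHom P Q ≫ mapOf (Bip.conc f g).hom hb (Bip.conc f g).tgt = g :=
    hom_ext (inr_conc f g)
  exact congrArg₂ comp ((map_comp _ _ _).symm.trans (congrArg (fun t => map t s) h1))
    ((map_comp _ _ _).symm.trans (congrArg (fun r => map r t) h2))

lemma op_conc (θ : k ⟶ l) (s : RigidSimplex P k) (t : RigidSimplex Q k) :
    (rigidHom.obj (wedge P Q)).map θ (conc s t) =
      conc ((rigidHom.obj P).map θ s) ((rigidHom.obj Q).map θ t) := by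
  exact (op_comp θ _ _).trans (congrArg₂ comp (map_op _ _ _) (map_op _ _ _))

/-- The unique simplex of the mapping space of the `0`-cube. -/
def unit (k : SimplexCategoryᵒᵖ) : RigidSimplex Bip.unit k := one k (𝟙 (cube 0))

lemma map_const (a : cube 0 ⟶ S) : map (const a) (unit k) = one k a :=
  map_mapOf_one a (Category.id_comp a)

lemma op_unit (θ : k ⟶ l) : (rigidHom.obj Bip.unit).map θ (unit k) = unit l :=
  op_one θ _

lemma map_leftUnit (s : RigidSimplex P k) : map (leftUnit P) s = conc (unit k) s := by
  have h : map (inlHom Bip.unit P) (unit k) = one k (Bip.unit.tgt ≫ inl Bip.unit P) :=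
    map_mapOf_one (inl Bip.unit P) rfl
  exact ((congrArg (fun t => comp t (map (inrHom Bip.unit P) s)) h).trans (one_comp _)).symm

lemma map_rightUnit (s : RigidSimplex P k) : map (rightUnit P).hom s = conc s (unit k) := by
  -- The middle vertex is by definition `P.tgt ≫ inl`, whereas the unit simplex sits at
  -- `Bip.unit.src ≫ inr`. With a variable middle vertex the equality can be substituted.
  have h : ∀ (m : cube 0 ⟶ (wedge P Bip.unit).X) (hm : Bip.unit.src ≫ inr P Bip.unit = m)
      (f : P ⟶ ⟨(wedge P Bip.unit).X, (wedge P Bip.unit).src, m⟩),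
      f.hom = inl P Bip.unit → map (rightUnit P).hom s =
        comp (c := (wedge P Bip.unit).tgt) (map f s)
          (map (mapOf (inr P Bip.unit) hm rfl) (unit k)) := by
    rintro _ rfl f hf
    have h1 : map (mapOf (inr P Bip.unit) rfl rfl) (unit k) =
      one k (Bip.unit.src ≫ inr P Bip.unit) := map_mapOf_one (inr P Bip.unit) rfl
    have h2 : (rightUnit P).hom = f := hom_ext hf.symm
    refine Eq.trans ?_ ((congrArg (comp (map f s)) h1).trans (comp_one _)).symm
    rw [h2]
    rfl
  exact h _ (condition P Bip.unit).symm (inlHom P Bip.unit) rfl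

lemma map_wmap (f : P ⟶ P') (g : Q ⟶ Q') (s : RigidSimplex P k) (t : RigidSimplex Q k) :
    map (wmap f g) (conc s t) = conc (map f s) (map g t) := by
  have e : wmap f g = Bip.conc (f ≫ inlHom P' Q') (g ≫ inrHom P' Q') := by
    apply wedge_hom_ext
    · rw [inl_wmap, inl_conc, comp_hom]; rfl
    · rw [inr_wmap, inr_conc, comp_hom]; rfl
  rw [e]
  refine (map_conc _ _ s t).trans ?_
  rw [map_comp, map_comp]
  rfl

lemma map_wedgeAssoc (s : RigidSimplex P k) (t : RigidSimplex Q k) (r : RigidSimplex R k) :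
    map (wedgeAssoc P Q R).hom (conc (conc s t) r) = conc s (conc t r) := by
  let W := wedge P (wedge Q R)
  let m : cube 0 ⟶ W.X := P.tgt ≫ inl P (wedge Q R)
  let m' : cube 0 ⟶ W.X := (Q.tgt ≫ inl Q R) ≫ inr P (wedge Q R)
  let f : P ⟶ ⟨W.X, W.src, m⟩ := ⟨inl P (wedge Q R), rfl, rfl⟩
  let j : wedge Q R ⟶ ⟨W.X, m, W.tgt⟩ := ⟨inr P (wedge Q R), (condition P _).symm, rfl⟩
  let j1 : (⟨(wedge Q R).X, (wedge Q R).src, Q.tgt ≫ inl Q R⟩ : Bip) ⟶ ⟨W.X, m, m'⟩ :=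
    mapOf (inr P (wedge Q R)) j.src rfl
  let j2 : (⟨(wedge Q R).X, Q.tgt ≫ inl Q R, (wedge Q R).tgt⟩ : Bip) ⟶ ⟨W.X, m', W.tgt⟩ :=
    mapOf (inr P (wedge Q R)) rfl j.tgt
  -- Written as a nested concatenation in `W`, the associator falls under `map_conc`, and
  -- associativity of composition finishes.
  have e : (wedgeAssoc P Q R).hom =
      Bip.conc (S := W.X) (Bip.conc f (inlHom Q R ≫ j1)) (inrHom Q R ≫ j2) := by
    apply wedge_hom_ext
    · apply wedge_ext
      · simp only [wedgeAssoc, inl_desc]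
        rw [inl_conc, inl_conc]
      · simp only [wedgeAssoc, inl_desc, inr_desc]
        rw [inl_conc, inr_conc]
        rfl
    · simp only [wedgeAssoc, inr_desc]
      rw [inr_conc]
      rfl
  rw [e]
  refine (map_conc _ _ _ _).trans ?_
  rw [map_conc, assoc]
  refine congrArg (comp (map f s)) ?_
  rw [map_comp, map_comp]
  exact (map_mapOf_comp (inr P (wedge Q R)) j.src rfl j.tgt _ _).symm

end RigidSimplex

/-! ### The colimit of the mapping spaces of necklaces -/

/-- Necklaces over `P` with a simplex of their mapping space. -/
def RawNeckSimplex (P : Bip) (k : SimplexCategoryᵒᵖ) : Type :=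
  Σ (l : List ℕ+) (_ : neck l ⟶ P), RigidSimplex (neck l) k

/-- Compatibility with maps of necklaces over `P`. -/
def RawNeckSimplex.Rel {P : Bip} {k : SimplexCategoryᵒᵖ} (x y : RawNeckSimplex P k) : Prop :=
  ∃ g : neck x.1 ⟶ neck y.1, g ≫ y.2.1 = x.2.1 ∧ RigidSimplex.map g x.2.2 = y.2.2

/-- The colimit of the simplices of the mapping spaces of the necklaces over `P`. -/
def NeckSimplex (P : Bip) (k : SimplexCategoryᵒᵖ) : Type :=
  Quot (RawNeckSimplex.Rel (P := P) (k := k))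

namespace NeckSimplex

variable {P Q R P' : Bip} {k l m : SimplexCategoryᵒᵖ} {S T : CubicalSet}
  {a b c d : cube 0 ⟶ S} {u v w : cube 0 ⟶ T}

/-- The class of a simplex of the mapping space of a necklace over `P`. -/
def mk {T : Bip} (hT : IsNeck T) (f : T ⟶ P) (s : RigidSimplex T k) : NeckSimplex P k :=
  Quot.mk _ ⟨hT.choose, hT.choose_spec.some.inv ≫ f, RigidSimplex.map hT.choose_spec.some.hom s⟩

/-- Classes can be compared through any map of objects isomorphic to necklaces; the isomorphisms
chosen in `mk` are irrelevant, and no list of beads has to be handled. -/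
lemma mk_eq {T T' : Bip} (hT : IsNeck T) (hT' : IsNeck T') {f : T ⟶ P} {f' : T' ⟶ P}
    {s : RigidSimplex T k} {s' : RigidSimplex T' k} (g : T ⟶ T') (hf : g ≫ f' = f)
    (hs : RigidSimplex.map g s = s') : mk hT f s = mk hT' f' s' := by
  subst hf hs
  refine Quot.sound ⟨hT.choose_spec.some.inv ≫ g ≫ hT'.choose_spec.some.hom, ?_, ?_⟩
  · simp
  · simp only [← RigidSimplex.map_comp, Iso.hom_inv_id_assoc]

lemma mk_neck {l : List ℕ+} (f : neck l ⟶ P) (s : RigidSimplex (neck l) k) :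
    mk (isNeck_neck l) f s = Quot.mk _ ⟨l, f, s⟩ := by
  refine Quot.sound ⟨(isNeck_neck l).choose_spec.some.inv, rfl, ?_⟩
  rw [← RigidSimplex.map_comp, Iso.hom_inv_id, RigidSimplex.map_id]

lemma exists_mk (x : NeckSimplex P k) : ∃ (T : Bip) (hT : IsNeck T) (f : T ⟶ P)
    (s : RigidSimplex T k), x = mk hT f s := by
  induction x using Quot.ind with
  | _ x => exact ⟨neck x.1, isNeck_neck _, x.2.1, x.2.2, (mk_neck _ _).symm⟩

/-- The map induced by a map of double pointed cubical sets. -/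
def map (h : P ⟶ Q) : NeckSimplex P k → NeckSimplex Q k :=
  Quot.map (fun x => ⟨x.1, x.2.1 ≫ h, x.2.2⟩) (by
    rintro x y ⟨g, hg, hs⟩
    exact ⟨g, by rw [← hg, Category.assoc], hs⟩)

lemma map_mk (h : P ⟶ Q) {T : Bip} (hT : IsNeck T) (f : T ⟶ P) (s : RigidSimplex T k) :
    map h (mk hT f s) = mk hT (f ≫ h) s :=
  congrArg (fun t => Quot.mk _ (⟨hT.choose, t, _⟩ : RawNeckSimplex Q k)) (Category.assoc _ _ _)

/-- The action of simplicial operators. -/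
def op (θ : k ⟶ l) : NeckSimplex P k → NeckSimplex P l :=
  Quot.map (fun x => ⟨x.1, x.2.1, (rigidHom.obj (neck x.1)).map θ x.2.2⟩) (by
    rintro x y ⟨g, hg, hs⟩
    exact ⟨g, hg, by rw [← hs, RigidSimplex.map_op]⟩)

lemma op_mk (θ : k ⟶ l) {T : Bip} (hT : IsNeck T) (f : T ⟶ P) (s : RigidSimplex T k) :
    op θ (mk hT f s) = mk hT f ((rigidHom.obj T).map θ s) :=
  congrArg (fun t => Quot.mk _ (⟨hT.choose, _, t⟩ : RawNeckSimplex P l))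
    (RigidSimplex.map_op _ _ _)

/-- The comparison map to the mapping space of `P`. -/
def eval : NeckSimplex P k → RigidSimplex P k :=
  Quot.lift (fun x => RigidSimplex.map x.2.1 x.2.2) (by
    rintro x y ⟨g, hg, hs⟩
    rw [← hg, ← hs, RigidSimplex.map_comp])

lemma eval_mk {T : Bip} (hT : IsNeck T) (f : T ⟶ P) (s : RigidSimplex T k) :
    eval (mk hT f s) = RigidSimplex.map f s := by
  refine (RigidSimplex.map_comp _ _ _).symm.trans ?_
  rw [Iso.hom_inv_id_assoc]

lemma eval_map (h : P ⟶ Q) (x : NeckSimplex P k) :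
    eval (map h x) = RigidSimplex.map h (eval x) := by
  obtain ⟨T, hT, f, s, rfl⟩ := x.exists_mk
  rw [map_mk, eval_mk, eval_mk, RigidSimplex.map_comp]

/-- Composition. -/
def comp (x : NeckSimplex ⟨S, a, b⟩ k) (y : NeckSimplex ⟨S, b, c⟩ k) :
    NeckSimplex ⟨S, a, c⟩ k :=
  Quot.lift₂ (fun x y => mk ((isNeck_neck x.1).wedge (isNeck_neck y.1)) (conc x.2.1 y.2.1)
      (RigidSimplex.conc x.2.2 y.2.2))
    (by
      rintro x y z ⟨g, hg, hs⟩
      refine mk_eq _ _ (wmap (𝟙 _) g) ?_ ?_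
      · rw [wmap_conc, hg, Category.id_comp]
      · rw [RigidSimplex.map_wmap, hs, RigidSimplex.map_id])
    (by
      rintro x y z ⟨g, hg, hs⟩
      refine mk_eq _ _ (wmap g (𝟙 _)) ?_ ?_
      · rw [wmap_conc, hg, Category.id_comp]
      · rw [RigidSimplex.map_wmap, hs, RigidSimplex.map_id]) x y

lemma comp_mk {T T' : Bip} (hT : IsNeck T) (hT' : IsNeck T') (f : T ⟶ ⟨S, a, b⟩)
    (g : T' ⟶ ⟨S, b, c⟩) (s : RigidSimplex T k) (t : RigidSimplex T' k) :
    comp (mk hT f s) (mk hT' g t) = mk (hT.wedge hT') (conc f g) (RigidSimplex.conc s t) := by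
  symm
  refine mk_eq _ _ (wmap hT.choose_spec.some.hom hT'.choose_spec.some.hom) ?_ ?_
  · rw [wmap_conc, Iso.hom_inv_id_assoc, Iso.hom_inv_id_assoc]
  · rw [RigidSimplex.map_wmap]

/-- The identity. -/
def one (k : SimplexCategoryᵒᵖ) (a : cube 0 ⟶ S) : NeckSimplex ⟨S, a, a⟩ k :=
  mk isNeck_unit (const a) (RigidSimplex.unit k)

lemma one_comp (x : NeckSimplex ⟨S, a, b⟩ k) : comp (one k a) x = x := by
  obtain ⟨T, hT, f, s, rfl⟩ := x.exists_mk
  rw [one, comp_mk]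
  exact (mk_eq _ _ (leftUnit T) (leftUnit_conc f) (RigidSimplex.map_leftUnit s)).symm

lemma comp_one (x : NeckSimplex ⟨S, a, b⟩ k) : comp x (one k b) = x := by
  obtain ⟨T, hT, f, s, rfl⟩ := x.exists_mk
  rw [one, comp_mk]
  exact (mk_eq _ _ (rightUnit T).hom (rightUnit_conc f) (RigidSimplex.map_rightUnit s)).symm

lemma assoc (x : NeckSimplex ⟨S, a, b⟩ k) (y : NeckSimplex ⟨S, b, c⟩ k)
    (z : NeckSimplex ⟨S, c, d⟩ k) : comp (comp x y) z = comp x (comp y z) := by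
  obtain ⟨T, hT, f, s, rfl⟩ := x.exists_mk
  obtain ⟨T', hT', f', s', rfl⟩ := y.exists_mk
  obtain ⟨T'', hT'', f'', s'', rfl⟩ := z.exists_mk
  rw [comp_mk, comp_mk, comp_mk, comp_mk]
  exact mk_eq _ _ (wedgeAssoc T T' T'').hom (wedgeAssoc_conc f f' f'')
    (RigidSimplex.map_wedgeAssoc _ _ _)

lemma op_comp (θ : k ⟶ l) (x : NeckSimplex ⟨S, a, b⟩ k) (y : NeckSimplex ⟨S, b, c⟩ k) :
    op θ (comp x y) = comp (op θ x) (op θ y) := by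
  obtain ⟨T, hT, f, s, rfl⟩ := x.exists_mk
  obtain ⟨T', hT', f', s', rfl⟩ := y.exists_mk
  rw [comp_mk, op_mk, op_mk, op_mk, comp_mk, RigidSimplex.op_conc]

lemma op_one (θ : k ⟶ l) (a : cube 0 ⟶ S) : op θ (one k a) = one l a := by
  rw [one, op_mk]
  exact congrArg (mk isNeck_unit (const a)) (RigidSimplex.op_unit θ)

lemma eval_comp (x : NeckSimplex ⟨S, a, b⟩ k) (y : NeckSimplex ⟨S, b, c⟩ k) :
    eval (comp x y) = RigidSimplex.comp (eval x) (eval y) := by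
  obtain ⟨T, hT, f, s, rfl⟩ := x.exists_mk
  obtain ⟨T', hT', f', s', rfl⟩ := y.exists_mk
  rw [comp_mk, eval_mk, eval_mk, eval_mk, RigidSimplex.map_conc]

lemma eval_one (a : cube 0 ⟶ S) : eval (one k a) = RigidSimplex.one k a := by
  rw [one, eval_mk, RigidSimplex.map_const]

lemma eval_op (θ : k ⟶ l) (x : NeckSimplex P k) :
    eval (op θ x) = (rigidHom.obj P).map θ (eval x) := by
  obtain ⟨T, hT, f, s, rfl⟩ := x.exists_mk
  rw [op_mk, eval_mk, eval_mk, RigidSimplex.map_op]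

lemma map_mapOf_comp (h : S ⟶ T) (ha : a ≫ h = u) (hb : b ≫ h = v) (hc : c ≫ h = w)
    (x : NeckSimplex ⟨S, a, b⟩ k) (y : NeckSimplex ⟨S, b, c⟩ k) :
    map (mapOf h ha hc) (comp x y) = comp (map (mapOf h ha hb) x) (map (mapOf h hb hc) y) := by
  obtain ⟨T, hT, f, s, rfl⟩ := x.exists_mk
  obtain ⟨T', hT', f', s', rfl⟩ := y.exists_mk
  rw [comp_mk, map_mk, map_mk, map_mk, comp_mk, conc_comp]

lemma map_mapOf_one (h : S ⟶ T) (ha : a ≫ h = u) :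
    map (mapOf h ha ha) (one k a) = one k u := by
  subst ha
  rw [one, map_mk]
  rfl

lemma map_id (x : NeckSimplex P k) : map (𝟙 P) x = x := by
  obtain ⟨T, hT, f, s, rfl⟩ := x.exists_mk
  rw [map_mk, Category.comp_id]

lemma map_comp (f : P ⟶ Q) (g : Q ⟶ R) (x : NeckSimplex P k) :
    map (f ≫ g) x = map g (map f x) := by
  obtain ⟨T, hT, h, s, rfl⟩ := x.exists_mk
  rw [map_mk, map_mk, map_mk, Category.assoc]

lemma op_map (f : P ⟶ Q) (θ : k ⟶ l) (x : NeckSimplex P k) :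
    op θ (map f x) = map f (op θ x) := by
  obtain ⟨T, hT, h, s, rfl⟩ := x.exists_mk
  rw [map_mk, op_mk, op_mk, map_mk]

lemma op_id (x : NeckSimplex P k) : op (𝟙 k) x = x := by
  obtain ⟨T, hT, h, s, rfl⟩ := x.exists_mk
  rw [op_mk, (rigidHom.obj T).map_id]
  rfl

lemma op_op (θ : k ⟶ l) (η : l ⟶ m) (x : NeckSimplex P k) :
    op (θ ≫ η) x = op η (op θ x) := by
  obtain ⟨T, hT, h, s, rfl⟩ := x.exists_mk
  rw [op_mk, op_mk, op_mk, (rigidHom.obj T).map_comp]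
  rfl

end NeckSimplex

/-! ### The simplicial category of necklaces -/

namespace SCat

lemma sMap_congr {C D : SCat} (F : C ⟶ D) {k : SimplexCategoryᵒᵖ} {x y x' y' : C.Obj}
    (hx : x = x') (hy : y = y') {f : (C.hom x y).obj k} {f' : (C.hom x' y').obj k}
    (h : HEq f f') : HEq (sMap F f) (sMap F f') := by
  subst hx hy; cases h; rfl

end SCat

/-- The simplicial set of necklaces over `P` with a simplex of their mapping space. -/
def neckSSet (P : Bip) : SSet.{0} where
  obj k := NeckSimplex P k
  map θ := ↾(NeckSimplex.op θ)
  map_id k := by ext x; exact NeckSimplex.op_id x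
  map_comp θ η := by ext x; exact NeckSimplex.op_op θ η x

/-- The simplicial category whose mapping spaces are the colimits of the mapping spaces of
necklaces. -/
def neckCat (S : CubicalSet) : SCat where
  Obj := cube 0 ⟶ S
  enriched := SCat.mkEnriched (cube 0 ⟶ S) (fun a b => neckSSet ⟨S, a, b⟩)
    (fun k a => NeckSimplex.one k a)
    (fun x y => NeckSimplex.comp x y)
    (fun θ a => NeckSimplex.op_one θ a)
    (fun θ _ _ _ x y => NeckSimplex.op_comp θ x y)
    (fun x => NeckSimplex.one_comp x)
    (fun x => NeckSimplex.comp_one x)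
    (fun x y z => NeckSimplex.assoc x y z)

lemma NeckSimplex.map_mapOf_heq {S T : CubicalSet} {a b : cube 0 ⟶ S} {u v u' v' : cube 0 ⟶ T}
    {h h' : S ⟶ T} (ha : a ≫ h = u) (hb : b ≫ h = v) (ha' : a ≫ h' = u') (hb' : b ≫ h' = v')
    (e : h = h') {k : SimplexCategoryᵒᵖ} (x : NeckSimplex ⟨S, a, b⟩ k) :
    HEq (NeckSimplex.map (mapOf h ha hb) x) (NeckSimplex.map (mapOf h' ha' hb') x) := by
  subst ha hb ha' hb' e; rfl

/-- The functor from cubical sets to simplicial categories obtained by taking colimits over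
necklaces. -/
def neckFunctor : CubicalSet ⥤ SCat where
  obj := neckCat
  map {S T} h := SCat.mkFunctor (C := neckCat S) (D := neckCat T) (fun a => a ≫ h)
    (fun {_ a b} x => NeckSimplex.map (mapOf (a := a) (b := b) h rfl rfl) x)
    (fun θ _ _ x => NeckSimplex.op_map _ θ x)
    (fun _ _ => NeckSimplex.map_mapOf_one h rfl)
    (fun x y => NeckSimplex.map_mapOf_comp h rfl rfl rfl x y)
  map_id S := by
    refine SCat.hext (fun a => Category.comp_id a) fun k a b x => ?_
    refine (NeckSimplex.map_mapOf_heq rfl rfl (Category.comp_id a) (Category.comp_id b) rfl x).trans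
      (heq_of_eq (NeckSimplex.map_id (P := ⟨S, a, b⟩) x))
  map_comp {S T U} f g := by
    refine SCat.hext (fun a => (Category.assoc a f g).symm) fun k a b x => ?_
    refine (NeckSimplex.map_mapOf_heq rfl rfl (Category.assoc a f g).symm
      (Category.assoc b f g).symm rfl x).trans (heq_of_eq ?_)
    exact NeckSimplex.map_comp (mapOf (a := a) (b := b) f rfl rfl) (mapOf g rfl rfl) x

/-- The comparison of the simplicial category of necklaces with the rigidification. -/
def neckComparison : neckFunctor ⟶ rigidification where
  app S := SCat.mkFunctor (C := neckCat S) (D := rigidification.obj S) (fun a => rigidVertex a)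
    (fun x => NeckSimplex.eval x)
    (fun θ _ _ x => (NeckSimplex.eval_op θ x).symm)
    (fun _ a => NeckSimplex.eval_one a)
    (fun x y => NeckSimplex.eval_comp x y)
  naturality S T f := by
    refine SCat.hext (fun a => (rigidVertex_comp a f).symm) fun k a b x => ?_
    refine (heq_of_eq (NeckSimplex.eval_map (mapOf (a := a) (b := b) f rfl rfl) x)).trans ?_
    exact RigidSimplex.map_heq _ _

/-! ### Simplices of mapping spaces of cubes -/

/-- The simplices of the mapping spaces of the simplicial category associated with a cube. -/
abbrev CubeSimplex (m : Box) (u v : (⟨0⟩ : Box) ⟶ m) (k : SimplexCategoryᵒᵖ) : Type :=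
  ((cubeRigidification.obj m).hom u v).obj k

namespace CubeSimplex

variable {m m' m'' : Box} {u v w : (⟨0⟩ : Box) ⟶ m} {u' v' w' : (⟨0⟩ : Box) ⟶ m'}
  {u'' v'' : (⟨0⟩ : Box) ⟶ m''} {k l : SimplexCategoryᵒᵖ}

/-- A vertex of the cube, as a map of cubical sets. -/
abbrev vtx {m : Box} (u : (⟨0⟩ : Box) ⟶ m) : cube 0 ⟶ yoneda.obj m := yoneda.map u

lemma vtx_comp (f : m ⟶ m') (h : u ≫ f = u') : vtx u ≫ yoneda.map f = vtx u' := by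
  rw [← h, ← yoneda.map_comp]

/-- The classes of paths that are the vertices of a simplex. -/
def vert (s : CubeSimplex m u v k) (i : Fin (k.unop.len + 1)) :
    Path.PathClass (yoneda.obj m) (vtx u) (vtx v) :=
  (show (nerve (Path.PathClass (yoneda.obj m) (vtx u) (vtx v))).obj k from s).obj i

/-- A simplex of the nerve of a preorder is determined by its vertices, so identities reduce to
classes of paths. -/
lemma ext {s t : CubeSimplex m u v k} (h : ∀ i, vert s i = vert t i) : s = t :=
  nerve.ext_of_isThin (C := Path.PathClass (yoneda.obj m) (vtx u) (vtx v)) (funext h)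

/-- The action of maps of cubes. -/
def map (f : m ⟶ m') (hu : u ≫ f = u') (hv : v ≫ f = v') (s : CubeSimplex m u v k) :
    CubeSimplex m' u' v' k :=
  show (nerve (Path.PathClass (yoneda.obj m') (vtx u') (vtx v'))).obj k from
  (show (nerve (Path.PathClass (yoneda.obj m) (vtx u) (vtx v))).obj k from s) ⋙
    Monotone.functor (f := Path.PathClass.map (yoneda.map f) (vtx_comp f hu) (vtx_comp f hv))
      fun _ _ h => Path.PathClass.map_mono _ _ _ h

lemma vert_map (f : m ⟶ m') (hu : u ≫ f = u') (hv : v ≫ f = v') (s : CubeSimplex m u v k)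
    (i) : vert (map f hu hv s) i =
      Path.PathClass.map (yoneda.map f) (vtx_comp f hu) (vtx_comp f hv) (vert s i) := rfl

lemma map_map (f : m ⟶ m') (g : m' ⟶ m'') (hu : u ≫ f = u') (hv : v ≫ f = v')
    (hu' : u' ≫ g = u'') (hv' : v' ≫ g = v'') (hu'' : u ≫ f ≫ g = u'') (hv'' : v ≫ f ≫ g = v'')
    (s : CubeSimplex m u v k) : map g hu' hv' (map f hu hv s) = map (f ≫ g) hu'' hv'' s := by
  refine ext fun i => ?_
  rw [vert_map, vert_map, vert_map]
  obtain ⟨n, γ, h⟩ := (vert s i).exists_mk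
  rw [h, Path.PathClass.map_mk, Path.PathClass.map_mk, Path.PathClass.map_mk]
  refine congrArg Path.PathClass.mk (Bip.hom_ext ?_)
  refine (Category.assoc _ _ _).trans ?_
  exact congrArg (fun t => γ.hom ≫ t) (yoneda.map_comp f g).symm

/-- Composition. -/
def comp (s : CubeSimplex m u v k) (t : CubeSimplex m v w k) : CubeSimplex m u w k :=
  (cubeRigidification.obj m).sComp s t

/-- The identity. -/
def one (k : SimplexCategoryᵒᵖ) (u : (⟨0⟩ : Box) ⟶ m) : CubeSimplex m u u k :=
  (cubeRigidification.obj m).sId k u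

lemma map_comp (f : m ⟶ m') (hu : u ≫ f = u') (hv : v ≫ f = v') (hw : w ≫ f = w')
    (s : CubeSimplex m u v k) (t : CubeSimplex m v w k) :
    map f hu hw (comp s t) = comp (map f hu hv s) (map f hv hw t) := by
  subst hu hv hw
  exact SCat.sMap_sComp (cubeRigidification.map f) s t

lemma map_one (f : m ⟶ m') (hu : u ≫ f = u') : map f hu hu (one k u) = one k u' := by
  subst hu
  exact SCat.sMap_sId (cubeRigidification.map f) u

/-- Naturality of the unit along `u`, evaluated at the only vertex of the `0`-cube. -/
lemma unit_obj (u : (⟨0⟩ : Box) ⟶ m) :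
    (rigidificationUnit.app m).obj u = rigidVertex (vtx u) := by
  have h := congrArg (fun G : cubeRigidification.obj ⟨0⟩ ⟶ rigidification.obj (yoneda.obj m) =>
    G.obj (𝟙 (⟨0⟩ : Box))) (rigidificationUnit.naturality u)
  refine Eq.trans ?_ h
  exact congrArg (rigidificationUnit.app m).obj (Category.id_comp u).symm

/-- The image of a simplex in the rigidification of the cube. -/
def toRigid (s : CubeSimplex m u v k) : RigidSimplex ⟨yoneda.obj m, vtx u, vtx v⟩ k :=
  (rigidification.obj (yoneda.obj m)).castHom (unit_obj u) (unit_obj v)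
    (SCat.sMap (rigidificationUnit.app m) s)

lemma toRigid_heq (s : CubeSimplex m u v k) :
    HEq (toRigid s) (SCat.sMap (rigidificationUnit.app m) s) :=
  SCat.castHom_heq _ _ _ _

lemma toRigid_comp (s : CubeSimplex m u v k) (t : CubeSimplex m v w k) :
    toRigid (comp s t) = RigidSimplex.comp (toRigid s) (toRigid t) := by
  apply eq_of_heq
  refine (toRigid_heq _).trans ?_
  refine (heq_of_eq (SCat.sMap_sComp (rigidificationUnit.app m) s t)).trans ?_
  exact SCat.sComp_heq (unit_obj u) (unit_obj v) (unit_obj w) (toRigid_heq s).symm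
    (toRigid_heq t).symm

lemma toRigid_one (u : (⟨0⟩ : Box) ⟶ m) :
    toRigid (one k u) = RigidSimplex.one k (vtx u) := by
  apply eq_of_heq
  refine (toRigid_heq _).trans ?_
  refine (heq_of_eq (SCat.sMap_sId (rigidificationUnit.app m) u)).trans ?_
  rw [unit_obj]
  rfl

lemma toRigid_map (f : m ⟶ m') (hu : u ≫ f = u') (hv : v ≫ f = v') (s : CubeSimplex m u v k) :
    toRigid (map f hu hv s) =
      RigidSimplex.map (mapOf (yoneda.map f) (vtx_comp f hu) (vtx_comp f hv)) (toRigid s) := by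
  subst hu hv
  apply eq_of_heq
  refine (toRigid_heq _).trans (HEq.trans ?_ (RigidSimplex.map_heq _ _).symm)
  refine HEq.trans ?_ (SCat.sMap_congr (rigidification.map (yoneda.map f)) (unit_obj u) (unit_obj v)
    (toRigid_heq s).symm)
  exact SCat.sMap_heq (rigidificationUnit.naturality f) s

/-- The coordinates of a vertex. -/
abbrev coords (u : (⟨0⟩ : Box) ⟶ m) : Fin m.dim → Bool := u.toFun fun _ => false

lemma vertex_coords (u : (⟨0⟩ : Box) ⟶ m) : Box.vertex (coords u) = u :=
  Box.hom_ext fun _ => congrArg u.toFun (Subsingleton.elim _ _)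

lemma coord_vtx (u : (⟨0⟩ : Box) ⟶ m) : coord (vtx u) = coords u := by
  rw [coord, yonedaEquiv_yoneda_map]

/-- Any representing path is a map out of some `I n`, which is bounded. A mapping space of a cube is
therefore empty unless its end points span an interval. -/
lemma le_of_pathClass (p : Path.PathClass (yoneda.obj m) (vtx u) (vtx v)) :
    coords u ≤ coords v := by
  obtain ⟨n, γ, -⟩ := p.exists_mk
  have h := (bounded_I n).le (m := m.dim) γ.hom
  rw [γ.src, γ.tgt] at h
  simpa only [coord_vtx] using h

lemma coords_le (s : CubeSimplex m u v k) : coords u ≤ coords v := le_of_pathClass (vert s 0)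

/-- Simplices of mapping spaces are invariant under retraction to an interval. -/
lemma map_retract {p : Box} {ι : p ⟶ m} {r : m ⟶ p} (h : Box.IsInterval ι.toFun r.toFun)
    (h0 : (ι.toFun fun _ => false) = coords u) (h1 : (ι.toFun fun _ => true) = coords v)
    (hu : u ≫ r ≫ ι = u) (hv : v ≫ r ≫ ι = v) (s : CubeSimplex m u v k) :
    map (r ≫ ι) hu hv s = s := by
  refine ext fun i => ?_
  rw [vert_map]
  obtain ⟨n, γ, hγ⟩ := (vert s i).exists_mk
  rw [hγ, Path.PathClass.map_mk]
  refine congrArg Path.PathClass.mk (Bip.hom_ext ?_)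
  refine Eq.trans ?_ ((bounded_I n).retract (m := m.dim) (p := p.dim) γ.hom h ?_ ?_)
  · exact congrArg (fun t => γ.hom ≫ t) (yoneda.map_comp r ι)
  · rw [γ.src, coord_vtx, h0]
  · rw [γ.tgt, coord_vtx, h1]

/-- The least vertex. -/
abbrev bot (p : ℕ) : (⟨0⟩ : Box) ⟶ ⟨p⟩ := Box.vertex fun _ => false

/-- The greatest vertex. -/
abbrev top (p : ℕ) : (⟨0⟩ : Box) ⟶ ⟨p⟩ := Box.vertex fun _ => true

/-- A map of cubes as a map of double pointed cubical sets. -/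
def boxHom {p : ℕ} (f : (⟨p⟩ : Box) ⟶ m) (hu : bot p ≫ f = u) (hv : top p ≫ f = v) :
    box p ⟶ ⟨yoneda.obj m, vtx u, vtx v⟩ :=
  ⟨yoneda.map f, vtx_comp f hu, vtx_comp f hv⟩

lemma exists_interval (h : coords u ≤ coords v) :
    ∃ (p : ℕ) (ι : (⟨p⟩ : Box) ⟶ m) (r : m ⟶ ⟨p⟩), Box.IsInterval ι.toFun r.toFun ∧
      bot p ≫ ι = u ∧ top p ≫ ι = v ∧ u ≫ r = bot p ∧ v ≫ r = top p := by
  obtain ⟨p, ι, r, hι, h0, h1⟩ := Box.exists_isInterval h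
  have hu : bot p ≫ (⟨ι, hι.incl⟩ : (⟨p⟩ : Box) ⟶ m) = u :=
    (congrArg Box.vertex h0).trans (vertex_coords u)
  have hv : top p ≫ (⟨ι, hι.incl⟩ : (⟨p⟩ : Box) ⟶ m) = v :=
    (congrArg Box.vertex h1).trans (vertex_coords v)
  refine ⟨p, ⟨ι, hι.incl⟩, ⟨r, hι.retr⟩, hι, hu, hv, ?_, ?_⟩
  · rw [← hu]; exact Box.hom_ext fun x => hι.retr_incl _
  · rw [← hv]; exact Box.hom_ext fun x => hι.retr_incl _

/-- A choice of an interval with given extremal vertices, with a retraction. -/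
structure Interval (u v : (⟨0⟩ : Box) ⟶ m) where
  p : ℕ
  ι : (⟨p⟩ : Box) ⟶ m
  r : m ⟶ ⟨p⟩
  isInterval : Box.IsInterval ι.toFun r.toFun
  bot_ι : bot p ≫ ι = u
  top_ι : top p ≫ ι = v
  r_bot : u ≫ r = bot p
  r_top : v ≫ r = top p

/-- The interval between the extremal vertices of a simplex. -/
def interval (h : coords u ≤ coords v) : Interval u v :=
  let h := exists_interval h
  ⟨h.choose, h.choose_spec.choose, h.choose_spec.choose_spec.choose,
    h.choose_spec.choose_spec.choose_spec.1,
    h.choose_spec.choose_spec.choose_spec.2.1,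
    h.choose_spec.choose_spec.choose_spec.2.2.1,
    h.choose_spec.choose_spec.choose_spec.2.2.2.1,
    h.choose_spec.choose_spec.choose_spec.2.2.2.2⟩

lemma Interval.ι_bot (I : Interval u v) : (I.ι.toFun fun _ => false) = coords u :=
  congrArg coords I.bot_ι

lemma Interval.ι_top (I : Interval u v) : (I.ι.toFun fun _ => true) = coords v :=
  congrArg coords I.top_ι

lemma Interval.comp_retract (I : Interval u v) {c : Box} (f : c ⟶ m)
    (h0 : ∀ x, coords u ≤ f.toFun x) (h1 : ∀ x, f.toFun x ≤ coords v) :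
    f ≫ I.r ≫ I.ι = f :=
  Box.hom_ext fun x => I.isInterval.incl_retr _ (I.ι_bot.le.trans (h0 x))
    ((h1 x).trans I.ι_top.ge)

/-- The class of a simplex of a mapping space of a cube in the colimit over necklaces. -/
def toNeck (s : CubeSimplex m u v k) : NeckSimplex ⟨yoneda.obj m, vtx u, vtx v⟩ k :=
  let I := interval (coords_le s)
  NeckSimplex.mk (isNeck_box I.p) (boxHom I.ι I.bot_ι I.top_ι)
    (toRigid (map I.r I.r_bot I.r_top s) : RigidSimplex (box I.p) k)

/-- Any cube mapped to `m` with extremal vertices sent to `u` and `v` factors through the interval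
between them, so every representative by a single cube defines the same class as the chosen
interval. -/
lemma mk_toRigid {q : ℕ} (f : (⟨q⟩ : Box) ⟶ m) (hu : bot q ≫ f = u) (hv : top q ≫ f = v)
    (s : CubeSimplex ⟨q⟩ (bot q) (top q) k) :
    NeckSimplex.mk (isNeck_box q) (boxHom f hu hv) (toRigid s : RigidSimplex (box q) k) =
      toNeck (map f hu hv s) := by
  let I := interval (coords_le (map f hu hv s))
  have hf : f ≫ I.r ≫ I.ι = f := by
    refine I.comp_retract f (fun x => ?_) (fun x => ?_)
    · rw [← hu]; exact f.isBoxMap.monotone fun j => Bool.false_le _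
    · rw [← hv]; exact f.isBoxMap.monotone fun j => Bool.le_true _
  have h0 : bot q ≫ f ≫ I.r = bot I.p := by rw [reassoc_of% hu, I.r_bot]
  have h1 : top q ≫ f ≫ I.r = top I.p := by rw [reassoc_of% hv, I.r_top]
  refine NeckSimplex.mk_eq _ _ (boxHom (f ≫ I.r) h0 h1) ?_ ?_
  · refine hom_ext ((yoneda.map_comp _ _).symm.trans (congrArg yoneda.map ?_))
    rw [Category.assoc, hf]
  · refine (toRigid_map (f ≫ I.r) h0 h1 s).symm.trans ?_
    exact congrArg toRigid (map_map f I.r hu hv I.r_bot I.r_top h0 h1 s).symm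

lemma map_toNeck (f : m ⟶ m') (hu : u ≫ f = u') (hv : v ≫ f = v') (s : CubeSimplex m u v k) :
    NeckSimplex.map (mapOf (yoneda.map f) (vtx_comp f hu) (vtx_comp f hv)) (toNeck s) =
      toNeck (map f hu hv s) := by
  let I := interval (coords_le s)
  have h0 : bot I.p ≫ I.ι ≫ f = u' := by rw [reassoc_of% I.bot_ι, hu]
  have h1 : top I.p ≫ I.ι ≫ f = v' := by rw [reassoc_of% I.top_ι, hv]
  have hu' : u ≫ I.r ≫ I.ι = u := by rw [reassoc_of% I.r_bot, I.bot_ι]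
  have hv' : v ≫ I.r ≫ I.ι = v := by rw [reassoc_of% I.r_top, I.top_ι]
  -- The simplex is first moved to the interval `I`. Since `I.ι ≫ f` need not be the chosen interval
  -- between `u'` and `v'`, the comparison is left to `mk_toRigid`.
  have e : map f hu hv s = map (I.ι ≫ f) h0 h1 (map I.r I.r_bot I.r_top s) := by
    rw [← map_map I.ι f I.bot_ι I.top_ι hu hv h0 h1,
      map_map I.r I.ι I.r_bot I.r_top I.bot_ι I.top_ι hu' hv',
      map_retract I.isInterval I.ι_bot I.ι_top]
  rw [e, ← mk_toRigid]
  refine (NeckSimplex.map_mk _ _ _ _).trans ?_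
  congr 1

/-- Retracting to the interval and including back fixes `s`. -/
lemma eval_toNeck (s : CubeSimplex m u v k) : (toNeck s).eval = toRigid s := by
  let I := interval (coords_le s)
  have hu' : u ≫ I.r ≫ I.ι = u := by rw [reassoc_of% I.r_bot, I.bot_ι]
  have hv' : v ≫ I.r ≫ I.ι = v := by rw [reassoc_of% I.r_top, I.top_ι]
  refine (NeckSimplex.eval_mk _ _ _).trans ?_
  refine (toRigid_map I.ι I.bot_ι I.top_ι _).symm.trans ?_
  rw [map_map I.r I.ι I.r_bot I.r_top I.bot_ι I.top_ι hu' hv',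
      map_retract I.isInterval I.ι_bot I.ι_top]

/-- The intervals from `u` to `v` and from `v` to `w` lie in the one from `u` to `w`. Their
concatenation maps to it, sending the concatenated simplex to the composite, and this map of
necklaces identifies the classes. -/
lemma toNeck_comp (s : CubeSimplex m u v k) (t : CubeSimplex m v w k) :
    toNeck (comp s t) = NeckSimplex.comp (toNeck s) (toNeck t) := by
  let I := interval (coords_le s)
  let J := interval (coords_le t)
  let K := interval (coords_le (comp s t))
  have huI : u ≫ I.r ≫ I.ι = u := by rw [reassoc_of% I.r_bot, I.bot_ι]
  have hvI : v ≫ I.r ≫ I.ι = v := by rw [reassoc_of% I.r_top, I.top_ι]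
  have hvJ : v ≫ J.r ≫ J.ι = v := by rw [reassoc_of% J.r_bot, J.bot_ι]
  have hwJ : w ≫ J.r ≫ J.ι = w := by rw [reassoc_of% J.r_top, J.top_ι]
  -- The vertex `v` in the coordinates of the large interval.
  obtain ⟨x, hx⟩ : ∃ x, v ≫ K.r = x := ⟨_, rfl⟩
  have hI0 : bot I.p ≫ I.ι ≫ K.r = bot K.p := by rw [reassoc_of% I.bot_ι, K.r_bot]
  have hI1 : top I.p ≫ I.ι ≫ K.r = x := by rw [reassoc_of% I.top_ι, hx]
  have hJ0 : bot J.p ≫ J.ι ≫ K.r = x := by rw [reassoc_of% J.bot_ι, hx]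
  have hJ1 : top J.p ≫ J.ι ≫ K.r = top K.p := by rw [reassoc_of% J.top_ι, K.r_top]
  have hI : I.ι ≫ K.r ≫ K.ι = I.ι := by
    refine K.comp_retract _ (fun y => ?_) (fun y => ?_)
    · exact I.ι_bot.ge.trans (I.ι.isBoxMap.monotone fun j => Bool.false_le _)
    · exact ((I.ι.isBoxMap.monotone fun j => Bool.le_true _).trans I.ι_top.le).trans (coords_le t)
  have hJ : J.ι ≫ K.r ≫ K.ι = J.ι := by
    refine K.comp_retract _ (fun y => ?_) (fun y => ?_)
    · exact (coords_le s).trans (J.ι_bot.ge.trans (J.ι.isBoxMap.monotone fun j => Bool.false_le _))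
    · exact (J.ι.isBoxMap.monotone fun j => Bool.le_true _).trans J.ι_top.le
  have eI : map (I.ι ≫ K.r) hI0 hI1 (map I.r I.r_bot I.r_top s) = map K.r K.r_bot hx s := by
    rw [← map_map I.ι K.r I.bot_ι I.top_ι K.r_bot hx,
      map_map I.r I.ι I.r_bot I.r_top I.bot_ι I.top_ι huI hvI,
      map_retract I.isInterval I.ι_bot I.ι_top]
  have eJ : map (J.ι ≫ K.r) hJ0 hJ1 (map J.r J.r_bot J.r_top t) = map K.r hx K.r_top t := by
    rw [← map_map J.ι K.r J.bot_ι J.top_ι hx K.r_top,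
      map_map J.r J.ι J.r_bot J.r_top J.bot_ι J.top_ι hvJ hwJ,
      map_retract J.isInterval J.ι_bot J.ι_top]
  have hx' : vtx x ≫ yoneda.map K.ι = vtx v := by
    refine vtx_comp _ ?_
    rw [← hI1, Category.assoc, Category.assoc, hI, I.top_ι]
  symm
  refine (NeckSimplex.comp_mk _ _ _ _ _ _).trans ?_
  refine NeckSimplex.mk_eq _ _ (P := ⟨yoneda.obj _, vtx _, vtx _⟩)
    (Bip.conc (boxHom (I.ι ≫ K.r) hI0 hI1) (boxHom (J.ι ≫ K.r) hJ0 hJ1)) ?_ ?_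
  · refine (conc_comp (boxHom (I.ι ≫ K.r) hI0 hI1) (boxHom (J.ι ≫ K.r) hJ0 hJ1) (yoneda.map K.ι)
      (vtx_comp _ K.bot_ι) hx' (vtx_comp _ K.top_ι)).trans ?_
    refine congrArg₂ Bip.conc (hom_ext ?_) (hom_ext ?_)
    · refine (yoneda.map_comp _ _).symm.trans (congrArg yoneda.map ?_)
      rw [Category.assoc, hI]
    · refine (yoneda.map_comp _ _).symm.trans (congrArg yoneda.map ?_)
      rw [Category.assoc, hJ]
  · refine (RigidSimplex.map_conc _ _ _ _).trans ?_
    rw [map_comp K.r K.r_bot hx K.r_top, toRigid_comp, ← eI, ← eJ]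
    exact congrArg₂ RigidSimplex.comp (toRigid_map (I.ι ≫ K.r) hI0 hI1 _).symm
      (toRigid_map (J.ι ≫ K.r) hJ0 hJ1 _).symm

lemma toNeck_one (u : (⟨0⟩ : Box) ⟶ m) : toNeck (one k u) = NeckSimplex.one k (vtx u) := by
  -- The extremal vertices of the interval from `u` to `u` coincide only propositionally; variable
  -- end points allow both to be replaced by `u ≫ r`.
  have key : ∀ {p : Box} (r : m ⟶ p) {x y : (⟨0⟩ : Box) ⟶ p} (hx : u ≫ r = x) (hy : u ≫ r = y)
      (g : unit ⟶ ⟨yoneda.obj p, vtx x, vtx y⟩),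
      RigidSimplex.map g (RigidSimplex.unit k) = toRigid (map r hx hy (one k u)) := by
    intro p r x y hx hy g
    subst hx
    subst hy
    have e : g = const (vtx (u ≫ r)) := hom_ext ((Category.id_comp _).symm.trans g.src)
    rw [e, map_one, toRigid_one]
    exact RigidSimplex.map_const _
  let I := interval (coords_le (one k u))
  have h : bot I.p = top I.p := I.r_bot.symm.trans I.r_top
  let g : unit ⟶ box I.p := ⟨vtx (bot I.p), Category.id_comp _,
    (Category.id_comp _).trans (congrArg yoneda.map h)⟩
  symm
  refine NeckSimplex.mk_eq _ _ g ?_ (key I.r I.r_bot I.r_top g)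
  exact hom_ext (vtx_comp _ I.bot_ι)

lemma op_toRigid (θ : k ⟶ l) (s : CubeSimplex m u v k) :
    (rigidHom.obj ⟨yoneda.obj m, vtx u, vtx v⟩).map θ (toRigid s) =
      toRigid (((cubeRigidification.obj m).hom u v).map θ s) := by
  have key : ∀ {C : SCat} {x y x' y' : C.Obj} (hx : x = x') (hy : y = y') (f : (C.hom x y).obj k),
      (C.hom x' y').map θ (C.castHom hx hy f) = C.castHom hx hy ((C.hom x y).map θ f) := by
    rintro C x y _ _ rfl rfl f
    rfl
  exact (key _ _ _).trans
    (congrArg (SCat.castHom _ (unit_obj u) (unit_obj v)) (SCat.map_sMap _ θ s))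

lemma op_toNeck (θ : k ⟶ l) (s : CubeSimplex m u v k) :
    NeckSimplex.op θ (toNeck s) = toNeck (((cubeRigidification.obj m).hom u v).map θ s) := by
  let I := interval (coords_le s)
  refine (NeckSimplex.op_mk θ _ _ _).trans ?_
  exact congrArg (NeckSimplex.mk (isNeck_box I.p) (boxHom I.ι I.bot_ι I.top_ι))
    (op_toRigid θ (map I.r I.r_bot I.r_top s))

end CubeSimplex

/-! ### The inverse comparison, from the universal property of the Kan extension -/

/-- The simplices of mapping spaces of cubes in the colimits over necklaces. -/
def cubeToNeck : cubeRigidification ⟶ yoneda ⋙ neckFunctor where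
  app m := SCat.mkFunctor (C := cubeRigidification.obj m) (D := neckCat (yoneda.obj m))
    (fun u => CubeSimplex.vtx u)
    (fun s => CubeSimplex.toNeck s)
    (fun θ _ _ s => CubeSimplex.op_toNeck θ s)
    (fun _ u => CubeSimplex.toNeck_one u)
    (fun s t => CubeSimplex.toNeck_comp s t)
  naturality m m' f := by
    refine SCat.hext (fun u => yoneda.map_comp u f) fun k u v s => ?_
    refine HEq.trans ?_ (NeckSimplex.map_mapOf_heq (h := yoneda.map f) (CubeSimplex.vtx_comp f rfl)
      (CubeSimplex.vtx_comp f rfl) rfl rfl rfl (CubeSimplex.toNeck s))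
    exact heq_of_eq (CubeSimplex.map_toNeck f rfl rfl s).symm

instance : rigidification.IsLeftKanExtension rigidificationUnit :=
  inferInstanceAs
    (((yoneda : Box ⥤ CubicalSet).leftKanExtension cubeRigidification).IsLeftKanExtension
      ((yoneda : Box ⥤ CubicalSet).leftKanExtensionUnit cubeRigidification))

/-- The comparison of the rigidification with the simplicial category of necklaces. -/
def rigidToNeck : rigidification ⟶ neckFunctor :=
  rigidification.descOfIsLeftKanExtension rigidificationUnit neckFunctor cubeToNeck

lemma rigidToNeck_fac (m : Box) :
    rigidificationUnit.app m ≫ rigidToNeck.app (yoneda.obj m) = cubeToNeck.app m :=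
  rigidification.descOfIsLeftKanExtension_fac_app rigidificationUnit neckFunctor cubeToNeck m

/-- Transformations out of a left Kan extension are determined on cubes, where the claim is
`CubeSimplex.eval_toNeck`. -/
lemma rigidToNeck_neckComparison : rigidToNeck ≫ neckComparison = 𝟙 rigidification := by
  apply rigidification.hom_ext_of_isLeftKanExtension rigidificationUnit
  ext m
  have h : cubeToNeck.app m ≫ neckComparison.app (yoneda.obj m) = rigidificationUnit.app m := by
    refine SCat.hext (fun u => (CubeSimplex.unit_obj u).symm) fun k u v s => ?_
    exact (heq_of_eq (CubeSimplex.eval_toNeck s)).trans (CubeSimplex.toRigid_heq s)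
  refine Eq.trans ?_ (h.trans (Category.comp_id _).symm)
  rw [← rigidToNeck_fac m]
  exact (Category.assoc _ _ _).symm

/-- Naturality along `a` reduces this to the `0`-cube, where `cubeToNeck` is explicit. -/
lemma rigidToNeck_obj {S : CubicalSet} (a : cube 0 ⟶ S) :
    (rigidToNeck.app S).obj (rigidVertex a) = a := by
  have h := congrArg (fun G : rigidification.obj (cube 0) ⟶ neckCat S =>
    G.obj ((rigidificationUnit.app ⟨0⟩).obj (𝟙 (⟨0⟩ : Box)))) (rigidToNeck.naturality a)
  refine h.trans ?_
  have h' := congrArg (fun G : cubeRigidification.obj ⟨0⟩ ⟶ neckCat (cube 0) =>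
    G.obj (𝟙 (⟨0⟩ : Box))) (rigidToNeck_fac ⟨0⟩)
  refine (congrArg (fun t : cube 0 ⟶ cube 0 => t ≫ a) (h'.trans (yoneda.map_id _))).trans ?_
  exact Category.id_comp a

namespace RigidSimplex

variable {P Q : Bip} {k : SimplexCategoryᵒᵖ}

/-- The inverse of the comparison map from the colimit over necklaces. -/
def toNeck (s : RigidSimplex P k) : NeckSimplex P k :=
  (neckCat P.X).castHom (rigidToNeck_obj P.src) (rigidToNeck_obj P.tgt)
    (SCat.sMap (rigidToNeck.app P.X) (x := rigidVertex P.src) (y := rigidVertex P.tgt) s)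

lemma toNeck_heq (s : RigidSimplex P k) : HEq (toNeck s)
    (SCat.sMap (rigidToNeck.app P.X) (x := rigidVertex P.src) (y := rigidVertex P.tgt) s) :=
  SCat.castHom_heq _ _ _ _

lemma eval_toNeck (s : RigidSimplex P k) : (toNeck s).eval = s := by
  apply eq_of_heq
  have h : HEq (SCat.sMap (neckComparison.app P.X) (x := P.src) (y := P.tgt) (toNeck s))
      (SCat.sMap (neckComparison.app P.X) (SCat.sMap (rigidToNeck.app P.X)
        (x := rigidVertex P.src) (y := rigidVertex P.tgt) s)) :=
    SCat.sMap_congr (neckComparison.app P.X) (rigidToNeck_obj P.src).symm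
      (rigidToNeck_obj P.tgt).symm (toNeck_heq s)
  exact h.trans (SCat.sMap_heq (NatTrans.congr_app rigidToNeck_neckComparison P.X) s)

lemma toNeck_map (f : P ⟶ Q) (s : RigidSimplex P k) :
    toNeck (map f s) = NeckSimplex.map f (toNeck s) := by
  obtain ⟨T, u, v⟩ := Q
  -- With the points of the target free, they can be replaced by the images of those of `P`.
  suffices key : ∀ (h : P.X ⟶ T) (hu : P.src ≫ h = u) (hv : P.tgt ≫ h = v),
      toNeck (map (⟨h, hu, hv⟩ : P ⟶ ⟨T, u, v⟩) s) =
        NeckSimplex.map (⟨h, hu, hv⟩ : P ⟶ ⟨T, u, v⟩) (toNeck s) from key f.hom f.src f.tgt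
  clear f
  rintro f rfl rfl
  apply eq_of_heq
  refine (toNeck_heq _).trans ?_
  let F : P ⟶ ⟨T, P.src ≫ f, P.tgt ≫ f⟩ := ⟨f, rfl, rfl⟩
  have h : HEq (SCat.sMap (rigidToNeck.app T) (x := rigidVertex (P.src ≫ f))
      (y := rigidVertex (P.tgt ≫ f)) (map F s))
      (SCat.sMap (rigidToNeck.app T) (SCat.sMap (rigidification.map f) (x := rigidVertex P.src)
        (y := rigidVertex P.tgt) s)) :=
    SCat.sMap_congr (rigidToNeck.app T) (rigidVertex_comp P.src f).symm
      (rigidVertex_comp P.tgt f).symm (map_heq F s)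
  refine h.trans ?_
  refine (SCat.sMap_heq (rigidToNeck.naturality f) (x := rigidVertex P.src)
    (y := rigidVertex P.tgt) s).trans ?_
  exact SCat.sMap_congr (neckFunctor.map f) (rigidToNeck_obj P.src) (rigidToNeck_obj P.tgt)
    (toNeck_heq s).symm

/-- A representative `g : T ⟶ P`, `s'` of the class on the left satisfies `map g s' = s`, because
evaluation is a left inverse of `toNeck`. As `P` is itself a necklace, `g` is a map of necklaces
over `P` from this representative to the tautological one. -/
lemma toNeck_of_isNeck (hP : IsNeck P) (s : RigidSimplex P k) :
    toNeck s = NeckSimplex.mk hP (𝟙 P) s := by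
  obtain ⟨T, hT, g, s', h⟩ := (toNeck s).exists_mk
  have h' : map g s' = s := by
    rw [← NeckSimplex.eval_mk hT g s', ← h, eval_toNeck]
  rw [h]
  exact NeckSimplex.mk_eq _ _ g (Category.comp_id g) h'

/-- Naturality of `toNeck` reduces the claim to the necklace carrying a representative of `x`. -/
lemma toNeck_eval (x : NeckSimplex P k) : toNeck x.eval = x := by
  obtain ⟨T, hT, f, s, rfl⟩ := x.exists_mk
  rw [NeckSimplex.eval_mk, toNeck_map, toNeck_of_isNeck hT, NeckSimplex.map_mk, Category.id_comp]

end RigidSimplex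

/-! ### Mapping spaces as colimits over necklaces -/

/-- The cocone of mapping spaces of the necklaces over `P`. -/
def neckOverCocone (P : Bip) : Cocone (CostructuredArrow.proj necIncl P ⋙ necIncl ⋙ rigidHom) where
  pt := rigidHom.obj P
  ι :=
    { app f := rigidHom.map f.hom
      naturality _ _ φ :=
        (rigidHom.map_comp _ _).symm.trans
          ((congrArg (fun ψ => rigidHom.map ψ) (CostructuredArrow.w φ)).trans
            (Category.comp_id _).symm) }

/-- The map from the colimit over necklaces induced by a cocone. -/
def NeckSimplex.desc {P : Bip} {k : SimplexCategoryᵒᵖ}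
    (c : Cocone (CostructuredArrow.proj necIncl P ⋙ necIncl ⋙ rigidHom)) :
    NeckSimplex P k → c.pt.obj k :=
  Quot.lift (fun x => (c.ι.app (CostructuredArrow.mk (S := necIncl) (Y := (show Nec from x.1))
      x.2.1)).app k x.2.2) (by
    rintro x y ⟨g, hg, hs⟩
    let X : NecOver P := CostructuredArrow.mk (S := necIncl) (Y := (show Nec from x.1)) x.2.1
    let Y : NecOver P := CostructuredArrow.mk (S := necIncl) (Y := (show Nec from y.1)) y.2.1
    let φ : X ⟶ Y := CostructuredArrow.homMk (necIncl.preimage g)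
      ((congrArg (fun t => t ≫ y.2.1) (necIncl.map_preimage g)).trans hg)
    have h := ConcreteCategory.congr_hom (NatTrans.congr_app (c.w φ) k) x.2.2
    refine h.symm.trans ?_
    refine congrArg ((c.ι.app Y).app k) (Eq.trans ?_ hs)
    exact congrArg (fun t => RigidSimplex.map t x.2.2) (necIncl.map_preimage g))

lemma NeckSimplex.desc_op {P : Bip} {k l : SimplexCategoryᵒᵖ} (θ : k ⟶ l)
    (c : Cocone (CostructuredArrow.proj necIncl P ⋙ necIncl ⋙ rigidHom)) (x : NeckSimplex P k) :
    desc c (op θ x) = c.pt.map θ (desc c x) := by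
  induction x using Quot.ind with
  | _ x =>
    exact ConcreteCategory.congr_hom ((c.ι.app (CostructuredArrow.mk (S := necIncl)
      (Y := (show Nec from x.1)) x.2.1)).naturality θ) x.2.2

/-- Inherited from `eval`, which is bijective and commutes with simplicial operators. -/
lemma RigidSimplex.toNeck_op {P : Bip} {k l : SimplexCategoryᵒᵖ} (θ : k ⟶ l)
    (s : RigidSimplex P k) :
    toNeck (P := P) ((rigidHom.obj P).map θ s) = NeckSimplex.op θ (toNeck s) := by
  rw [← toNeck_eval (NeckSimplex.op θ (toNeck s)), NeckSimplex.eval_op, eval_toNeck]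

lemma NeckSimplex.desc_toNeck {P : Bip} {k : SimplexCategoryᵒᵖ}
    (c : Cocone (CostructuredArrow.proj necIncl P ⋙ necIncl ⋙ rigidHom)) (f : NecOver P)
    (s : RigidSimplex (necIncl.obj f.left) k) :
    desc c (RigidSimplex.toNeck (RigidSimplex.map f.hom s)) = (c.ι.app f).app k s := by
  rw [RigidSimplex.toNeck_map, RigidSimplex.toNeck_of_isNeck (isNeck_neck f.left),
    NeckSimplex.map_mk, Category.id_comp]
  exact congrArg (desc c) (mk_neck (l := f.left) f.hom s)

/-- The mapping spaces of the rigidification are colimits over necklaces. -/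
def isColimitNeckOverCocone (P : Bip) : IsColimit (neckOverCocone P) where
  desc c :=
    { app k := ↾fun s => NeckSimplex.desc c (RigidSimplex.toNeck (P := P) s)
      naturality k l θ := by
        ext s
        exact (congrArg (NeckSimplex.desc c) (RigidSimplex.toNeck_op θ s)).trans
          (NeckSimplex.desc_op θ c _) }
  fac c f := by
    ext k s
    exact NeckSimplex.desc_toNeck c f s
  uniq c m hm := by
    ext k s
    -- Every simplex comes from a necklace, where the cocone equations prescribe the value of `m`.
    obtain ⟨x, rfl⟩ : ∃ x : NeckSimplex P k, x.eval = s := ⟨_, RigidSimplex.eval_toNeck (P := P) s⟩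
    refine Eq.trans ?_ (congrArg (NeckSimplex.desc c) (RigidSimplex.toNeck_eval x)).symm
    induction x using Quot.ind with
    | _ x =>
      exact ConcreteCategory.congr_hom (NatTrans.congr_app (hm (CostructuredArrow.mk (S := necIncl)
        (Y := (show Nec from x.1)) x.2.1)) k) x.2.2

end CubicalRigidification
end

open CubicalRigidification
theorem mainTheorem9 (n : ℕ) (S : CubicalSet) (i : S ⟶ cube n) [Mono i] (a b : S.Vertex) :
    (subNeckIncl ⟨S, CubicalSet.pt a, CubicalSet.pt b⟩).Final ∧
      Nonempty (IsColimit (subNeckCocone ⟨S, CubicalSet.pt a, CubicalSet.pt b⟩)) := by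
  have h := final_subNeckIncl i (CubicalSet.pt a) (CubicalSet.pt b)
  -- `subNeckCocone` is by definition the restriction of `neckOverCocone` along the inclusion, so
  -- finality transfers the colimit property.
  exact ⟨h, ⟨(Functor.Final.isColimitWhiskerEquiv (subNeckIncl _) (neckOverCocone _)).symm
    (isColimitNeckOverCocone _)⟩⟩
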